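/- For integers $2\le k\le N$ and boundary rates $\delta=(\delta_i)_{2\le i\le k-1}$ with $\delta_i\ge 0$, the *$S_k$ shuffle with boundary rates $\delta$* is the continuous-time Markov chain on the symmetric group $\mathcal S_N$ (a configuration $\zeta$ assigns to each position $m\in[N]=\{1,\dots,N\}$ the label $\zeta(m)$ of the card at $m$) in which each of the $N-k+1$ blocks $\{a,\dots,a+k-1\}\subseteq[N]$ is updated at rate $1$ and, for each $2\le i\le k-1$, the blocks $\{1,\dots,i\}$ and $\{N-i+1,\dots,N\}$ are each updated at rate $\delta_i$; all clocks are independent Poisson clocks, and an update of a block rearranges the cards in it by a uniformly random permutation. (The rates are thus symmetric under reflection of the deck; $\delta\equiv 0$ gives the $S_k$ shuffle without boundaries.) The *canonical coupling* $\mathbf P$ of two such shuffles $(\zeta_t)_{t\ge0}$, $(\zeta'_t)_{t\ge0}$ uses the same clocks for both. When a block is updated, the labels lying in this block in both configurations are put, in both configurations, at the same uniformly chosen distinct positions of the block, and the remaining cards of the block are distributed uniformly at random on the remaining positions of the block, independently in the two configurations. Write $\|\mu-\nu\|_{\mathrm{TV}}=\frac12\sum_{\eta\in\mathcal S_N}|\mu(\eta)-\nu(\eta)|$.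 There exists an absolute constant $C>0$ such that the following holds. 1. Let $k=k(N)\ge 2$ with $k=o(N^{2/3})$. Then for all $N$ sufficiently large (depending only on the sequence $k(\cdot)$), all boundary rates $\delta_i\in[0,1]$ ($2\le i\le k-1$), all $\sigma,\sigma'\in\mathcal S_N$ and all $t\ge C N^2k^{-3}\log N$, the two marginals at time $t$ of the canonical coupling started from $(\sigma,\sigma')$ are the laws at time $t$ of the $S_k$ shuffle with boundary rates $\delta$ started from $\sigma$ and from $\sigma'$, respectively, and $$\big\|\mathbf P(\zeta'_t\in\cdot\mid\zeta'_0=\sigma')-\mathbf P(\zeta_t\in\cdot\mid\zeta_0=\sigma)\big\|_{\mathrm{TV}}\le \frac1N .$$ 2. Let $k=k(N)\ge2$ with $k=o(N)$, and take the boundary rates $\delta^{(k)}_2,\dots,\delta^{(k)}_{k-1}$ given by $$\delta^{(k)}_{k-i}=\frac{4k^2-6ik+3i^2-1}{(2(k-i)+1)(2(k-i)-1)},\qquad 1\le i\le k-2 .$$ Then for all $N$ sufficiently large (depending only on the sequence $k(\cdot)$), all $\sigma,\sigma'\in\mathcal S_N$ and all $t\ge CN^2k^{-3}\log N$, the same conclusion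 holds. -/

import Mathlib

open Filter Asymptotics
open scoped Nat

namespace SkShuffle

/-! ### Finite-state continuous-time Markov chains -/

section MarkovChain

variable {S : Type*} [Fintype S] [DecidableEq S]

/-- The matrix `Q x y = (G 1_{y})(x)` of a linear operator `G` on real functions on a finite set. -/
def generatorMatrix (G : (S → ℝ) → S → ℝ) : Matrix S S ℝ :=
  Matrix.of fun x y => G (Pi.single y 1) x

/-- The law at time `t` of the continuous-time Markov chain on `S` with generator `G` started
from `x`: the row `x` of the transition matrix `exp (t Q)`. -/
noncomputable def lawAt (G : (S → ℝ) → S → ℝ) (t : ℝ) (x : S) : S → ℝ :=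
  NormedSpace.exp (t • generatorMatrix G) x

/-- Total-variation distance of two mass functions on a finite set. -/
noncomputable def tvDist (μ ν : S → ℝ) : ℝ := (1 / 2) * ∑ x, |μ x - ν x|

end MarkovChain

/-- First marginal of a mass function on a product. -/
def fstMarginal {S S' : Type*} [Fintype S'] (J : S × S' → ℝ) : S → ℝ := fun x => ∑ y, J (x, y)

/-- Second marginal of a mass function on a product. -/
def sndMarginal {S S' : Type*} [Fintype S] (J : S × S' → ℝ) : S' → ℝ := fun y => ∑ x, J (x, y)

/-! ### Decks of cards

A configuration of a deck of `N` cards is `η : Equiv.Perm (Fin N)`; `η m` is the label of the card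
at position `m`, hence `η.symm ℓ` is the position of the card labelled `ℓ`. Positions and labels
are numbered from `0`. -/

/-- The block of the `l` consecutive positions `a, a + 1, …, a + l - 1`. -/
def block (N a l : ℕ) : Finset (Fin N) :=
  Finset.univ.filter fun m => a ≤ (m : ℕ) ∧ (m : ℕ) < a + l

/-- The configuration `m ↦ η (σ m)` for `m ∈ B`, and `m ↦ η m` for `m ∉ B`. -/
def permuteBlock {N : ℕ} (B : Finset (Fin N)) (η : Equiv.Perm (Fin N))
    (σ : Equiv.Perm {m // m ∈ B}) : Equiv.Perm (Fin N) :=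
  η * Equiv.Perm.ofSubtype σ

/-- Generator of the dynamics which, at rate one, applies a uniform permutation to the cards in
the block `B`. -/
noncomputable def blockGen {N : ℕ} (B : Finset (Fin N)) (f : Equiv.Perm (Fin N) → ℝ)
    (η : Equiv.Perm (Fin N)) : ℝ :=
  (1 / (B.card ! : ℝ)) * ∑ σ : Equiv.Perm {m // m ∈ B}, (f (permuteBlock B η σ) - f η)

/-- Given, for each block `B`, the generator `U B` of the updates of `B` at rate one, the generator
of the dynamics in which each of the `N - k + 1` blocks of `k` consecutive positions is updated at
rate one and, for every `2 ≤ i ≤ k - 1`, the first `i` positions and the last `i` positions are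
each updated at rate `δ i`. -/
noncomputable def blockDynamics {X : Type*} (N k : ℕ) (δ : ℕ → ℝ)
    (U : Finset (Fin N) → (X → ℝ) → X → ℝ) (f : X → ℝ) (x : X) : ℝ :=
  ∑ a ∈ Finset.range (N - k + 1), U (block N a k) f x +
    ∑ i ∈ Finset.Icc 2 (k - 1), δ i * (U (block N 0 i) f x + U (block N (N - i) i) f x)

/-- Generator of the `S_k` shuffle on `N` cards with boundary rates `δ`. -/
noncomputable def shuffleGen (N k : ℕ) (δ : ℕ → ℝ) :
    (Equiv.Perm (Fin N) → ℝ) → Equiv.Perm (Fin N) → ℝ :=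
  blockDynamics N k δ blockGen

/-- The law at time `t` of the `S_k` shuffle with boundary rates `δ` started from `η`. -/
noncomputable def shuffleLaw (N k : ℕ) (δ : ℕ → ℝ) (t : ℝ) (η : Equiv.Perm (Fin N)) :
    Equiv.Perm (Fin N) → ℝ :=
  lawAt (shuffleGen N k δ) t η

/-! ### The canonical coupling -/

/-- The possible outcomes of a coupled update of the block `B`: in both decks only the cards in `B`
are rearranged, and every label which is in the block `B` in both decks is put at the same position
in both. A uniform element of this set is obtained by choosing uniformly the positions of the
common labels, and then distributing the other cards of the block of each deck uniformly and
independently on the remaining positions of `B`. -/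
def coupledOutcomes {N : ℕ} (B : Finset (Fin N)) (x : Equiv.Perm (Fin N) × Equiv.Perm (Fin N)) :
    Finset (Equiv.Perm (Fin N) × Equiv.Perm (Fin N)) :=
  Finset.univ.filter fun y =>
    (∀ m, m ∉ B → y.1 m = x.1 m) ∧ (∀ m, m ∉ B → y.2 m = x.2 m) ∧
      ∀ ℓ, x.1.symm ℓ ∈ B → x.2.symm ℓ ∈ B → y.1.symm ℓ = y.2.symm ℓ

/-- Generator of the coupled updates of the block `B` at rate one. -/
noncomputable def coupledBlockGen {N : ℕ} (B : Finset (Fin N))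
    (f : Equiv.Perm (Fin N) × Equiv.Perm (Fin N) → ℝ)
    (x : Equiv.Perm (Fin N) × Equiv.Perm (Fin N)) : ℝ :=
  (1 / ((coupledOutcomes B x).card : ℝ)) * ∑ y ∈ coupledOutcomes B x, (f y - f x)

/-- Generator of the canonical coupling of two `S_k` shuffles with boundary rates `δ`: both decks
use the same clocks. -/
noncomputable def couplingGen (N k : ℕ) (δ : ℕ → ℝ) :
    (Equiv.Perm (Fin N) × Equiv.Perm (Fin N) → ℝ) →
      Equiv.Perm (Fin N) × Equiv.Perm (Fin N) → ℝ :=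
  blockDynamics N k δ coupledBlockGen

/-- The joint law at time `t` of the canonically coupled shuffles started from `(σ, σ')`. -/
noncomputable def couplingLaw (N k : ℕ) (δ : ℕ → ℝ) (t : ℝ) (σ σ' : Equiv.Perm (Fin N)) :
    Equiv.Perm (Fin N) × Equiv.Perm (Fin N) → ℝ :=
  lawAt (couplingGen N k δ) t (σ, σ')

/-- The special boundary rates: with `i = k - j`,
`δ_j = (4k² - 6ik + 3i² - 1) / ((2(k - i) + 1)(2(k - i) - 1))`. -/
noncomputable def specialRate (k j : ℕ) : ℝ :=
  let i : ℝ := (k : ℝ) - j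
  (4 * (k : ℝ) ^ 2 - 6 * i * k + 3 * i ^ 2 - 1) /
    ((2 * ((k : ℝ) - i) + 1) * (2 * ((k : ℝ) - i) - 1))

/-- The canonical coupling with boundary rates `δ` does couple the two shuffles started from `σ`
and `σ'` at time `t`, and its two marginals are then within total-variation distance `1 / N`. -/
def CloseAt (N k : ℕ) (δ : ℕ → ℝ) (t : ℝ) (σ σ' : Equiv.Perm (Fin N)) : Prop :=
  fstMarginal (couplingLaw N k δ t σ σ') = shuffleLaw N k δ t σ ∧
  sndMarginal (couplingLaw N k δ t σ σ') = shuffleLaw N k δ t σ' ∧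
  tvDist (sndMarginal (couplingLaw N k δ t σ σ')) (fstMarginal (couplingLaw N k δ t σ σ')) ≤
    1 / (N : ℝ)

end SkShuffle

/-!
The proof compares the two decks card by card. In the canonical coupling a block containing exactly
one of the two copies of a card moves that copy within an interval avoiding the other copy, and a
block containing both makes them merge; hence the order of the two positions `X_t`, `Y_t` of a card
never changes (`symm_le_symm_of_mem_coupledOutcomes`). Consequently
`P(X_t ≠ Y_t) ≤ E|X_t - Y_t| = |E X_t - E Y_t|` (`sum_couplingLaw_abs_sub_le`), and the right-hand
side involves the marginals only: `E X_t` is the semigroup of the motion of a single card, applied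
to the identity function. By a union bound over the cards and the coupling inequality, it suffices
that this function becomes constant up to `N⁻³` by time `C N² k⁻³ log N`. Since the counting measure
is invariant for the single card, this follows from a spectral gap of order `k³ / N²` and
exponential decay in `L²` (`sum_expect_sq_le`).

The Dirichlet form of a single card is the sum over the blocks, with their rates, of the variation
`∑_{x ∈ B} (f x - avg_B f)²`. The averages over two blocks of length `k` that overlap in half their
length differ by at most the variations over these blocks, so chaining along steps of length `k / 2`
shows that all block averages are close to a constant (`exists_sum_sq_sub_le`). A position at
distance at least `k / 2` from the ends lies in order `k` blocks, which gives the Poincaré inequality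
up to the variations over the two end segments of length `k / 2` (`variation_range_le`). These are
where the two regimes differ. If `k³ ≤ N²`, the single block at each end of the deck is enough, as
the time scale `N² / k³` is at least one (`endVariation_le_of_cube_le`). With the special rates, all
boundary rates are at least one, and the boundary blocks of length at least `k / 2` mix the end
segments at rate at least `k / 2` (`endVariation_le_of_one_le`).

That the marginals of the coupling are the shuffles, and that the position of a card is a Markov
chain, are instances of lumping (`expect_comp`).
-/

/-! ### Finite-state chains: semigroup, lumping, positivity and `L²` decay -/

namespace SkShuffle

section Semigroup

variable {S T : Type*} [Fintype S] [DecidableEq S] [Fintype T] [DecidableEq T]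

/-- The expectation of `f` at time `t`, as a function of the starting point, for the chain with
generator `G`. -/
noncomputable def expect (G : (S → ℝ) → S → ℝ) (t : ℝ) (f : S → ℝ) (x : S) : ℝ :=
  ∑ y, lawAt G t x y * f y

theorem generatorMatrix_mulVec {G : (S → ℝ) → S → ℝ} (hG : IsLinearMap ℝ G) (f : S → ℝ) :
    (generatorMatrix G).mulVec f = G f := by
  have hf : f = ∑ y, f y • (Pi.single y 1 : S → ℝ) := by
    ext z
    simp [Finset.sum_apply, Pi.single_apply]
  have h2 : G f = ∑ y, f y • G (Pi.single y 1 : S → ℝ) := by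
    conv_lhs => rw [hf]
    change hG.mk' G _ = _
    rw [map_sum]
    exact Finset.sum_congr rfl fun y _ => hG.map_smul _ _
  rw [h2]
  ext x
  simp [Matrix.mulVec, dotProduct, generatorMatrix, Finset.sum_apply, mul_comm]

theorem expect_eq_mulVec (G : (S → ℝ) → S → ℝ) (t : ℝ) (f : S → ℝ) :
    expect G t f = (NormedSpace.exp (t • generatorMatrix G)).mulVec f := rfl

open scoped Matrix.Norms.Operator in
theorem hasSum_exp_mulVec (A : Matrix S S ℝ) (f : S → ℝ) (x : S) :
    HasSum (fun n : ℕ => ((n ! : ℝ))⁻¹ * (A ^ n).mulVec f x)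
      ((NormedSpace.exp A).mulVec f x) := by
  have h := NormedSpace.exp_series_hasSum_exp' (𝕂 := ℝ) A
  let Φ : Matrix S S ℝ →+ ℝ :=
    { toFun := fun M => M.mulVec f x
      map_zero' := by simp
      map_add' := fun M M' => by simp [Matrix.add_mulVec] }
  have hΦ : Continuous Φ := by
    change Continuous fun M : Matrix S S ℝ => ∑ y, M x y * f y
    fun_prop
  have := h.map Φ hΦ
  convert this using 2 with n
  · simp [Φ, Matrix.smul_mulVec]
  · rfl

theorem hasSum_expect {G : (S → ℝ) → S → ℝ} (hG : IsLinearMap ℝ G) (t : ℝ) (f : S → ℝ) (x : S) :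
    HasSum (fun n : ℕ => ((n ! : ℝ))⁻¹ * t ^ n * (G^[n] f) x) (expect G t f x) := by
  have h := hasSum_exp_mulVec (t • generatorMatrix G) f x
  have hpow : ∀ n : ℕ, (generatorMatrix G ^ n).mulVec f = G^[n] f := by
    intro n
    induction n with
    | zero => simp
    | succ n ih =>
      rw [pow_succ', ← Matrix.mulVec_mulVec, ih, generatorMatrix_mulVec hG,
        Function.iterate_succ_apply']
  rw [expect_eq_mulVec]
  convert h using 2 with n
  rw [smul_pow, Matrix.smul_mulVec, hpow]
  simp [mul_assoc]

theorem lawAt_eq_expect (G : (S → ℝ) → S → ℝ) (t : ℝ) (x y : S) :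
    lawAt G t x y = expect G t (Pi.single y 1) x := by
  simp [expect, Pi.single_apply]

/-- If `π` lumps the chain with generator `G` into the chain with generator `G'`, then functions of
`π` have the same expectations in both chains. -/
theorem expect_comp {G : (S → ℝ) → S → ℝ} {G' : (T → ℝ) → T → ℝ} (hG : IsLinearMap ℝ G)
    (hG' : IsLinearMap ℝ G') (π : S → T) (h : ∀ g : T → ℝ, G (g ∘ π) = G' g ∘ π)
    (t : ℝ) (g : T → ℝ) (x : S) : expect G t (g ∘ π) x = expect G' t g (π x) := by
  have hit : ∀ n : ℕ, G^[n] (g ∘ π) = G'^[n] g ∘ π := by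
    intro n
    induction n with
    | zero => rfl
    | succ n ih => rw [Function.iterate_succ_apply', ih, h, Function.iterate_succ_apply']
  refine (hasSum_expect hG t _ x).unique ?_
  simpa [hit] using hasSum_expect hG' t g (π x)

/-- A chain started in a set that it cannot leave has its law supported on that set. -/
theorem lawAt_eq_zero_of_closed {G : (S → ℝ) → S → ℝ} (hG : IsLinearMap ℝ G) {A : Set S}
    (hA : ∀ x ∈ A, ∀ y ∉ A, G (Pi.single y 1) x = 0) (t : ℝ) {x y : S} (hx : x ∈ A) (hy : y ∉ A) :
    lawAt G t x y = 0 := by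
  have hit : ∀ n : ℕ, ∀ z ∈ A, (G^[n] (Pi.single y 1 : S → ℝ)) z = 0 := by
    intro n
    induction n with
    | zero =>
      intro z hz
      have : z ≠ y := fun h => hy (h ▸ hz)
      simp [this]
    | succ n ih =>
      intro z hz
      rw [Function.iterate_succ_apply', ← generatorMatrix_mulVec hG]
      refine Finset.sum_eq_zero fun w _ => ?_
      by_cases hw : w ∈ A
      · simp [ih w hw]
      · simp [generatorMatrix, hA z hz w hw]
  rw [lawAt_eq_expect]
  refine (hasSum_expect hG t _ x).unique ?_
  simp [hit _ x hx]

/-- The transition probabilities of a generator with nonnegative off-diagonal rates are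
nonnegative. -/
theorem lawAt_nonneg {G : (S → ℝ) → S → ℝ} (hG : ∀ x y, y ≠ x → 0 ≤ G (Pi.single y 1) x)
    {t : ℝ} (ht : 0 ≤ t) (x y : S) : 0 ≤ lawAt G t x y := by
  set Q := generatorMatrix G with hQ
  -- Adding a large multiple of the identity makes the matrix entrywise nonnegative.
  set c : ℝ := ∑ z, |Q z z| with hc
  have hR : ∀ z w, 0 ≤ (Q + c • (1 : Matrix S S ℝ)) z w := by
    intro z w
    by_cases h : w = z
    · subst h
      have : |Q w w| ≤ c :=
        Finset.single_le_sum (f := fun z => |Q z z|) (fun _ _ => abs_nonneg _) (Finset.mem_univ w)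
      simp only [Matrix.add_apply, Matrix.smul_apply, Matrix.one_apply_eq, smul_eq_mul, mul_one]
      linarith [neg_abs_le (Q w w)]
    · simpa [Matrix.one_apply_ne (Ne.symm h), hQ, generatorMatrix] using hG z w h
  set R := t • (Q + c • (1 : Matrix S S ℝ)) with hRdef
  have hR' : ∀ z w, 0 ≤ R z w := fun z w => mul_nonneg ht (hR z w)
  have hpow : ∀ n : ℕ, ∀ z w, 0 ≤ (R ^ n) z w := by
    intro n
    induction n with
    | zero => intro z w; rw [pow_zero, Matrix.one_apply]; split_ifs <;> norm_num
    | succ n ih =>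
      intro z w
      rw [pow_succ, Matrix.mul_apply]
      exact Finset.sum_nonneg fun _ _ => mul_nonneg (ih _ _) (hR' _ _)
  have hexp : ∀ z w, 0 ≤ NormedSpace.exp R z w := by
    intro z w
    have h := hasSum_exp_mulVec R (Pi.single w 1) z
    have h0 : 0 ≤ (NormedSpace.exp R).mulVec (Pi.single w 1) z :=
      h.nonneg fun n => mul_nonneg (by positivity) (by simpa using hpow n z w)
    simpa using h0
  have hsplit : t • Q = R + Matrix.diagonal (fun _ => -(t * c)) := by
    ext z w
    by_cases h : z = w
    · subst h; simp [hRdef]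
    · simp [hRdef, h]
  have hcomm : Commute R (Matrix.diagonal fun _ : S => -(t * c)) := by
    have : (Matrix.diagonal fun _ : S => -(t * c)) = Matrix.scalar S (-(t * c)) := rfl
    rw [this]
    exact (Matrix.scalar_commute _ (fun _ => Commute.all _ _) R).symm
  unfold lawAt
  rw [← hQ, hsplit, Matrix.exp_add_of_commute _ _ hcomm, Matrix.exp_diagonal, Matrix.mul_diagonal]
  refine mul_nonneg (hexp _ _) ?_
  rw [Pi.coe_exp, ← Real.exp_eq_exp_ℝ]
  positivity

open scoped Matrix.Norms.Operator in
theorem hasDerivAt_expect {G : (S → ℝ) → S → ℝ} (hG : IsLinearMap ℝ G) (f : S → ℝ) (t : ℝ)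
    (x : S) : HasDerivAt (fun s => expect G s f x) (G (expect G t f) x) t := by
  have h := hasDerivAt_exp_smul_const' (𝕂 := ℝ) (generatorMatrix G) t
  let Φ : Matrix S S ℝ →ₗ[ℝ] ℝ :=
    { toFun := fun M => M.mulVec f x
      map_add' := fun M M' => by simp [Matrix.add_mulVec]
      map_smul' := fun c M => by simp [Matrix.smul_mulVec] }
  have h2 := (LinearMap.toContinuousLinearMap Φ).hasFDerivAt.comp_hasDerivAt t h
  rw [← generatorMatrix_mulVec hG, expect_eq_mulVec, Matrix.mulVec_mulVec]
  exact h2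

theorem expect_zero (G : (S → ℝ) → S → ℝ) (f : S → ℝ) : expect G 0 f = f := by
  simp [expect_eq_mulVec]

theorem expect_const {G : (S → ℝ) → S → ℝ} (hG : IsLinearMap ℝ G) (h1 : G (fun _ => 1) = 0)
    (t c : ℝ) (x : S) : expect G t (fun _ => c) x = c := by
  have hc : G (fun _ => c) = 0 := by
    have := hG.map_smul c (fun _ => (1 : ℝ))
    rw [h1, smul_zero] at this
    simpa [Pi.smul_def] using this
  have h0 : ∀ n : ℕ, G^[n] 0 = 0 := fun n => Function.iterate_fixed hG.map_zero n
  refine (hasSum_expect hG t _ x).unique ?_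
  convert hasSum_single (f := fun n : ℕ => ((n ! : ℝ))⁻¹ * t ^ n * (G^[n] fun _ => c) x) 0 ?_ using 1
  · simp
  · intro n hn
    obtain ⟨m, rfl⟩ := Nat.exists_eq_succ_of_ne_zero hn
    simp [hc, h0]

/-- Exponential decay in `L²` of the centred functions, from a Poincaré inequality for a generator
that leaves the counting measure invariant. -/
theorem sum_expect_sq_le {G : (S → ℝ) → S → ℝ} (hG : IsLinearMap ℝ G)
    (hinv : ∀ f, ∑ x, G f x = 0) {c : ℝ}
    (hgap : ∀ f : S → ℝ, ∑ x, f x = 0 → ∑ x, f x * G f x ≤ -c * ∑ x, f x ^ 2)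
    {f : S → ℝ} (hf : ∑ x, f x = 0) {t : ℝ} (ht : 0 ≤ t) :
    ∑ x, expect G t f x ^ 2 ≤ Real.exp (-(2 * c * t)) * ∑ x, f x ^ 2 := by
  have hsum : ∀ s, ∑ x, expect G s f x = 0 := by
    have hd : ∀ s, HasDerivAt (fun s => ∑ x, expect G s f x) 0 s := by
      intro s
      have := HasDerivAt.fun_sum (u := Finset.univ) fun x _ => hasDerivAt_expect hG f s x
      rwa [hinv] at this
    intro s
    have := is_const_of_deriv_eq_zero (fun s => (hd s).differentiableAt) (fun s => (hd s).deriv) s 0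
    simpa [expect_zero, hf] using this
  have hd : ∀ s, HasDerivAt (fun s => Real.exp (2 * c * s) * ∑ x, expect G s f x ^ 2)
      (Real.exp (2 * c * s) * (2 * c) * ∑ x, expect G s f x ^ 2 +
        Real.exp (2 * c * s) * ∑ x, 2 * (expect G s f x * G (expect G s f) x)) s := by
    intro s
    refine HasDerivAt.mul ?_ ?_
    · simpa using ((hasDerivAt_id s).const_mul (2 * c)).exp
    · refine HasDerivAt.fun_sum fun x _ => ?_
      have := (hasDerivAt_expect hG f s x).fun_pow 2
      simpa [mul_assoc] using this
  have hanti : Antitone fun s => Real.exp (2 * c * s) * ∑ x, expect G s f x ^ 2 := by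
    refine antitone_of_hasDerivAt_nonpos hd fun s => ?_
    have := hgap _ (hsum s)
    rw [← Finset.mul_sum, mul_assoc, ← mul_add]
    refine mul_nonpos_of_nonneg_of_nonpos (Real.exp_pos _).le ?_
    linarith
  have h := hanti ht
  simp only [expect_zero, mul_zero, Real.exp_zero, one_mul] at h
  rw [Real.exp_neg, inv_mul_eq_div, le_div_iff₀ (Real.exp_pos _), mul_comm]
  exact h

/-- Total variation is bounded by the probability that the two components of a coupling differ. -/
theorem tvDist_marginals_le {J : S × S → ℝ} (hJ : ∀ x, 0 ≤ J x) :
    tvDist (sndMarginal J) (fstMarginal J) ≤ ∑ x : S × S, if x.1 = x.2 then 0 else J x := by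
  have key : ∀ x, |sndMarginal J x - fstMarginal J x| ≤
      ∑ y, (if y = x then 0 else J (y, x)) + ∑ y, (if x = y then 0 else J (x, y)) := by
    intro x
    have h1 : sndMarginal J x - fstMarginal J x =
        ∑ y, (if y = x then 0 else J (y, x)) - ∑ y, (if x = y then 0 else J (x, y)) := by
      unfold sndMarginal fstMarginal
      rw [← Finset.sum_sub_distrib, ← Finset.sum_sub_distrib]
      refine Finset.sum_congr rfl fun y _ => ?_
      by_cases h : y = x
      · subst h; simp
      · simp [h, Ne.symm h]
    have hn : ∀ a b : S, 0 ≤ (if a = b then 0 else J (a, b)) := by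
      intro a b
      split_ifs
      exacts [le_rfl, hJ _]
    have h2 : 0 ≤ ∑ y, (if y = x then 0 else J (y, x)) := Finset.sum_nonneg fun y _ => hn y x
    have h3 : 0 ≤ ∑ y, (if x = y then 0 else J (x, y)) := Finset.sum_nonneg fun y _ => hn x y
    rw [h1, abs_le]
    constructor <;> linarith
  have h := Finset.sum_le_sum fun x (_ : x ∈ Finset.univ) => key x
  rw [Finset.sum_add_distrib, Finset.sum_comm] at h
  rw [tvDist, Fintype.sum_prod_type]
  linarith

end Semigroup

end SkShuffle

namespace SkShuffle

/-! ### Block updates -/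

section BlockDynamics

variable {X : Type*} {N k : ℕ} {δ : ℕ → ℝ} {U : Finset (Fin N) → (X → ℝ) → X → ℝ}

theorem blockDynamics_isLinearMap (hU : ∀ B, IsLinearMap ℝ (U B)) :
    IsLinearMap ℝ (blockDynamics N k δ U) where
  map_add f g := by
    ext x
    simp only [blockDynamics, (hU _).map_add, Pi.add_apply, Finset.sum_add_distrib, mul_add]
    ring
  map_smul c f := by
    ext x
    simp only [blockDynamics, (hU _).map_smul, Pi.smul_apply, smul_eq_mul, Finset.mul_sum, mul_add]
    congr 1
    refine Finset.sum_congr rfl fun i _ => ?_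
    ring

theorem blockDynamics_eq_zero {f : X → ℝ} {x : X} (h : ∀ a l, U (block N a l) f x = 0) :
    blockDynamics N k δ U f x = 0 := by
  simp [blockDynamics, h]

theorem blockDynamics_nonneg {f : X → ℝ} {x : X} (hδ : ∀ i ∈ Finset.Icc 2 (k - 1), 0 ≤ δ i)
    (h : ∀ B, 0 ≤ U B f x) : 0 ≤ blockDynamics N k δ U f x :=
  add_nonneg (Finset.sum_nonneg fun _ _ => h _)
    (Finset.sum_nonneg fun i hi => mul_nonneg (hδ i hi) (add_nonneg (h _) (h _)))

theorem blockDynamics_comp {Y : Type*} {U' : Finset (Fin N) → (Y → ℝ) → Y → ℝ} {π : X → Y}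
    {g : Y → ℝ} (h : ∀ B, U B (g ∘ π) = U' B g ∘ π) :
    blockDynamics N k δ U (g ∘ π) = blockDynamics N k δ U' g ∘ π := by
  ext x
  simp [blockDynamics, h]

end BlockDynamics

variable {N : ℕ} {B : Finset (Fin N)}

theorem blockGen_isLinearMap (B : Finset (Fin N)) : IsLinearMap ℝ (blockGen B) where
  map_add f g := by
    ext x
    simp only [blockGen, Pi.add_apply, ← mul_add, ← Finset.sum_add_distrib]
    congr 1
    refine Finset.sum_congr rfl fun i _ => ?_
    ring
  map_smul c f := by
    ext x
    simp only [blockGen, Pi.smul_apply, smul_eq_mul, ← mul_sub, ← Finset.mul_sum]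
    ring

theorem coupledBlockGen_isLinearMap (B : Finset (Fin N)) : IsLinearMap ℝ (coupledBlockGen B) where
  map_add f g := by
    ext x
    simp only [coupledBlockGen, Pi.add_apply, ← mul_add, ← Finset.sum_add_distrib]
    congr 1
    refine Finset.sum_congr rfl fun i _ => ?_
    ring
  map_smul c f := by
    ext x
    simp only [coupledBlockGen, Pi.smul_apply, smul_eq_mul, ← mul_sub, ← Finset.mul_sum]
    ring

theorem shuffleGen_isLinearMap (N k : ℕ) (δ : ℕ → ℝ) : IsLinearMap ℝ (shuffleGen N k δ) :=
  blockDynamics_isLinearMap blockGen_isLinearMap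

theorem couplingGen_isLinearMap (N k : ℕ) (δ : ℕ → ℝ) : IsLinearMap ℝ (couplingGen N k δ) :=
  blockDynamics_isLinearMap coupledBlockGen_isLinearMap

/-! ### The motion of a single card -/

/-- The average of `f` over a finite set. -/
noncomputable def avg {α : Type*} (s : Finset α) (f : α → ℝ) : ℝ := (∑ x ∈ s, f x) / (s.card : ℝ)

/-- Generator of the motion of a single card under the updates of the block `B` at rate one: a card
in the block jumps to a uniform position of the block. -/
noncomputable def cardBlockGen (B : Finset (Fin N)) (g : Fin N → ℝ) (m : Fin N) : ℝ :=
  if m ∈ B then avg B g - g m else 0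

/-- Generator of the motion of a single card in the `S_k` shuffle. -/
noncomputable def cardGen (N k : ℕ) (δ : ℕ → ℝ) : (Fin N → ℝ) → Fin N → ℝ :=
  blockDynamics N k δ cardBlockGen

theorem cardBlockGen_isLinearMap (B : Finset (Fin N)) : IsLinearMap ℝ (cardBlockGen B) where
  map_add f g := by
    ext x
    by_cases h : x ∈ B <;> simp [cardBlockGen, avg, h, Finset.sum_add_distrib]
    ring
  map_smul c f := by
    ext x
    by_cases h : x ∈ B <;> simp [cardBlockGen, avg, h, ← Finset.mul_sum]
    ring

theorem cardGen_isLinearMap (N k : ℕ) (δ : ℕ → ℝ) : IsLinearMap ℝ (cardGen N k δ) :=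
  blockDynamics_isLinearMap cardBlockGen_isLinearMap

/-- A uniform permutation sends each point to a uniform point. -/
theorem sum_perm_apply {α : Type*} [Fintype α] [DecidableEq α] (F : α → ℝ) (x : α) :
    ∑ σ : Equiv.Perm α, F (σ x) = ((Fintype.card α)! : ℝ) * ((∑ y, F y) / Fintype.card α) := by
  have hx : ∀ y, ∑ σ : Equiv.Perm α, F (σ y) = ∑ σ : Equiv.Perm α, F (σ x) := by
    intro y
    refine Fintype.sum_equiv (Equiv.mulRight (Equiv.swap x y)) _ _ fun σ => ?_
    simp
  have h : ∑ y, ∑ σ : Equiv.Perm α, F (σ y) = ((Fintype.card α)! : ℝ) * ∑ y, F y := by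
    rw [Finset.sum_comm]
    simp [Equiv.sum_comp, Fintype.card_perm]
  simp only [hx, Finset.sum_const, Finset.card_univ, nsmul_eq_mul] at h
  have : (Fintype.card α : ℝ) ≠ 0 := by
    have := Fintype.card_pos_iff.mpr ⟨x⟩
    positivity
  field_simp
  linarith

theorem blockGen_comp_symm (B : Finset (Fin N)) (ℓ : Fin N) (g : Fin N → ℝ) :
    blockGen B (g ∘ fun η => η.symm ℓ) = cardBlockGen B g ∘ fun η => η.symm ℓ := by
  ext η
  have hpos : ∀ σ : Equiv.Perm {m // m ∈ B},
      (permuteBlock B η σ).symm ℓ = Equiv.Perm.ofSubtype σ⁻¹ (η.symm ℓ) := by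
    intro σ
    rw [Equiv.symm_apply_eq, permuteBlock]
    simp
  by_cases h : η.symm ℓ ∈ B
  · have hsum : ∑ σ : Equiv.Perm {m // m ∈ B}, g ((permuteBlock B η σ).symm ℓ) =
        ((B.card)! : ℝ) * avg B g := by
      have := sum_perm_apply (fun m : {m // m ∈ B} => g m) ⟨η.symm ℓ, h⟩
      rw [Fintype.card_coe, Finset.sum_coe_sort B g] at this
      rw [avg, ← this]
      refine Fintype.sum_equiv (Equiv.inv _) _ _ fun σ => ?_
      rw [hpos, Equiv.Perm.ofSubtype_apply_of_mem _ h]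
      rfl
    have : ((B.card)! : ℝ) ≠ 0 := by positivity
    simp only [blockGen, Function.comp_apply, Finset.sum_sub_distrib, hsum, cardBlockGen, h,
      if_true, Finset.sum_const, Finset.card_univ, Fintype.card_perm, Fintype.card_coe,
      nsmul_eq_mul]
    field_simp
  · have : ∀ σ : Equiv.Perm {m // m ∈ B}, (permuteBlock B η σ).symm ℓ = η.symm ℓ := by
      intro σ
      rw [hpos, Equiv.Perm.ofSubtype_apply_of_not_mem _ h]
    simp [blockGen, this, cardBlockGen, h]

/-- The position of a given card is an autonomous Markov chain. -/
theorem expect_shuffleGen_comp_symm (N k : ℕ) (δ : ℕ → ℝ) (t : ℝ) (ℓ : Fin N) (g : Fin N → ℝ)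
    (η : Equiv.Perm (Fin N)) :
    expect (shuffleGen N k δ) t (fun η => g (η.symm ℓ)) η =
      expect (cardGen N k δ) t g (η.symm ℓ) :=
  expect_comp (shuffleGen_isLinearMap N k δ) (cardGen_isLinearMap N k δ) (fun η => η.symm ℓ)
    (fun g => blockDynamics_comp fun B => blockGen_comp_symm B ℓ g) t g η

/-! ### The canonical coupling -/

theorem eq_permuteBlock_of_eq_off {η η' : Equiv.Perm (Fin N)} (h : ∀ m, m ∉ B → η' m = η m) :
    ∃ σ : Equiv.Perm {m // m ∈ B}, η' = permuteBlock B η σ := by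
  have hfix : ∀ m, m ∉ B → (η⁻¹ * η') m = m := by
    intro m hm
    simp [h m hm]
  have hB : ∀ m, (η⁻¹ * η') m ∈ B ↔ m ∈ B := by
    intro m
    constructor
    · intro h1
      by_contra h2
      exact h2 (hfix m h2 ▸ h1)
    · intro h1
      by_contra h2
      have := (η⁻¹ * η').injective (hfix _ h2)
      exact h2 (this.symm ▸ h1)
  refine ⟨(η⁻¹ * η').subtypePerm hB, ?_⟩
  rw [permuteBlock, Equiv.Perm.ofSubtype_subtypePerm]
  · simp
  · intro m hm
    by_contra h2
    exact hm (hfix m h2)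

theorem coupledOutcomes_nonempty (B : Finset (Fin N)) (x : Equiv.Perm (Fin N) × Equiv.Perm (Fin N)) :
    (coupledOutcomes B x).Nonempty := by
  -- Leave the first deck as it is; in the second, move every common card to its position in the
  -- first one and complete this partial matching to a permutation of the block.
  let e : {b : {m // m ∈ B} // x.2.symm (x.1 b) ∈ B} ≃ {b : {m // m ∈ B} // x.1.symm (x.2 b) ∈ B} :=
    { toFun := fun b => ⟨⟨x.2.symm (x.1 b.1), b.2⟩, by simp [b.1.2]⟩
      invFun := fun b => ⟨⟨x.1.symm (x.2 b.1), b.2⟩, by simp [b.1.2]⟩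
      left_inv := fun b => by simp
      right_inv := fun b => by simp }
  refine ⟨(x.1, permuteBlock B x.2 e.extendSubtype), ?_⟩
  simp only [coupledOutcomes, Finset.mem_filter, Finset.mem_univ, true_and, implies_true]
  refine ⟨fun m hm => ?_, fun ℓ h1 h2 => ?_⟩
  · simp [permuteBlock, Equiv.Perm.ofSubtype_apply_of_not_mem _ hm]
  · symm
    rw [Equiv.symm_apply_eq, permuteBlock, Equiv.Perm.mul_apply,
      Equiv.Perm.ofSubtype_apply_of_mem _ h1, Equiv.extendSubtype_apply_of_mem e _ (by simpa using h2)]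
    simp [e]

theorem permuteBlock_permuteBlock (η : Equiv.Perm (Fin N)) (σ τ : Equiv.Perm {m // m ∈ B}) :
    permuteBlock B (permuteBlock B η σ) τ = permuteBlock B η (σ * τ) := by
  simp [permuteBlock, mul_assoc]

theorem permuteBlock_mem_coupledOutcomes {x y : Equiv.Perm (Fin N) × Equiv.Perm (Fin N)}
    (hy : y ∈ coupledOutcomes B x) (τ : Equiv.Perm {m // m ∈ B}) :
    (permuteBlock B y.1 τ, permuteBlock B y.2 τ) ∈ coupledOutcomes B x := by
  simp only [coupledOutcomes, Finset.mem_filter, Finset.mem_univ, true_and] at hy ⊢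
  obtain ⟨h1, h2, h3⟩ := hy
  refine ⟨fun m hm => ?_, fun m hm => ?_, fun ℓ hl hl' => ?_⟩
  · simp [permuteBlock, Equiv.Perm.ofSubtype_apply_of_not_mem _ hm, h1 m hm]
  · simp [permuteBlock, Equiv.Perm.ofSubtype_apply_of_not_mem _ hm, h2 m hm]
  · have h := h3 ℓ hl hl'
    rw [Equiv.symm_apply_eq, permuteBlock, permuteBlock, Equiv.Perm.mul_apply,
      Equiv.Perm.mul_def, Equiv.symm_trans_apply, Equiv.apply_symm_apply, ← h,
      Equiv.apply_symm_apply]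

/-- The coupled outcomes are invariant under permuting the block in both decks simultaneously;
averaging over these permutations turns each of the two decks into a uniform rearrangement. -/
theorem sum_coupledOutcomes (x : Equiv.Perm (Fin N) × Equiv.Perm (Fin N))
    (p : Equiv.Perm (Fin N) × Equiv.Perm (Fin N) → Equiv.Perm (Fin N))
    (hp : ∀ y ∈ coupledOutcomes B x, ∀ m, m ∉ B → p y m = p x m)
    (hτ : ∀ y τ, p (permuteBlock B y.1 τ, permuteBlock B y.2 τ) = permuteBlock B (p y) τ)
    (f : Equiv.Perm (Fin N) → ℝ) :
    ((B.card)! : ℝ) * ∑ y ∈ coupledOutcomes B x, f (p y) =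
      ((coupledOutcomes B x).card : ℝ) * ∑ τ : Equiv.Perm {m // m ∈ B}, f (permuteBlock B (p x) τ) := by
  have h1 : ∀ τ : Equiv.Perm {m // m ∈ B}, ∑ y ∈ coupledOutcomes B x, f (p y) =
      ∑ y ∈ coupledOutcomes B x, f (permuteBlock B (p y) τ) := by
    intro τ
    refine (Finset.sum_nbij' (fun y => (permuteBlock B y.1 τ, permuteBlock B y.2 τ))
      (fun y => (permuteBlock B y.1 τ⁻¹, permuteBlock B y.2 τ⁻¹))
      (fun y hy => permuteBlock_mem_coupledOutcomes hy τ)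
      (fun y hy => permuteBlock_mem_coupledOutcomes hy τ⁻¹) ?_ ?_ ?_).symm
    · intro y _
      ext1 <;> simp only [permuteBlock_permuteBlock, mul_inv_cancel] <;> simp [permuteBlock]
    · intro y _
      ext1 <;> simp only [permuteBlock_permuteBlock, inv_mul_cancel] <;> simp [permuteBlock]
    · intro y _
      rw [hτ]
  have h2 : ∀ y ∈ coupledOutcomes B x, ∑ τ : Equiv.Perm {m // m ∈ B}, f (permuteBlock B (p y) τ) =
      ∑ τ : Equiv.Perm {m // m ∈ B}, f (permuteBlock B (p x) τ) := by
    intro y hy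
    obtain ⟨σ, hσ⟩ := eq_permuteBlock_of_eq_off (hp y hy)
    refine Fintype.sum_equiv (Equiv.mulLeft σ) _ _ fun τ => ?_
    rw [hσ, permuteBlock_permuteBlock]
    rfl
  calc ((B.card)! : ℝ) * ∑ y ∈ coupledOutcomes B x, f (p y)
      = ∑ τ : Equiv.Perm {m // m ∈ B}, ∑ y ∈ coupledOutcomes B x, f (p y) := by
        simp [Fintype.card_perm]
    _ = ∑ y ∈ coupledOutcomes B x, ∑ τ : Equiv.Perm {m // m ∈ B}, f (permuteBlock B (p y) τ) := by
        rw [Finset.sum_congr rfl fun τ _ => h1 τ, Finset.sum_comm]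
    _ = _ := by
        rw [Finset.sum_congr rfl h2]
        simp

theorem coupledBlockGen_comp (p : Equiv.Perm (Fin N) × Equiv.Perm (Fin N) → Equiv.Perm (Fin N))
    (hp : ∀ x, ∀ y ∈ coupledOutcomes B x, ∀ m, m ∉ B → p y m = p x m)
    (hτ : ∀ y τ, p (permuteBlock B y.1 τ, permuteBlock B y.2 τ) = permuteBlock B (p y) τ)
    (f : Equiv.Perm (Fin N) → ℝ) :
    coupledBlockGen B (f ∘ p) = blockGen B f ∘ p := by
  ext x
  have h := sum_coupledOutcomes x p (hp x) hτ f
  have h1 : ((coupledOutcomes B x).card : ℝ) ≠ 0 := by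
    exact_mod_cast (Finset.card_pos.mpr (coupledOutcomes_nonempty B x)).ne'
  have h2 : ((B.card)! : ℝ) ≠ 0 := by positivity
  simp only [coupledBlockGen, blockGen, Function.comp_apply, Finset.sum_sub_distrib,
    Finset.sum_const, Finset.card_univ, Fintype.card_perm, Fintype.card_coe, nsmul_eq_mul]
  field_simp
  linear_combination h

theorem coupledBlockGen_comp_fst (B : Finset (Fin N)) (f : Equiv.Perm (Fin N) → ℝ) :
    coupledBlockGen B (f ∘ Prod.fst) = blockGen B f ∘ Prod.fst :=
  coupledBlockGen_comp Prod.fst (fun _ _ hy => (Finset.mem_filter.mp hy).2.1) (fun _ _ => rfl) f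

theorem coupledBlockGen_comp_snd (B : Finset (Fin N)) (f : Equiv.Perm (Fin N) → ℝ) :
    coupledBlockGen B (f ∘ Prod.snd) = blockGen B f ∘ Prod.snd :=
  coupledBlockGen_comp Prod.snd (fun _ _ hy => (Finset.mem_filter.mp hy).2.2.1) (fun _ _ => rfl) f

theorem expect_couplingGen_fst (N k : ℕ) (δ : ℕ → ℝ) (t : ℝ) (f : Equiv.Perm (Fin N) → ℝ)
    (x : Equiv.Perm (Fin N) × Equiv.Perm (Fin N)) :
    expect (couplingGen N k δ) t (fun y => f y.1) x = expect (shuffleGen N k δ) t f x.1 :=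
  expect_comp (couplingGen_isLinearMap N k δ) (shuffleGen_isLinearMap N k δ) Prod.fst
    (fun g => blockDynamics_comp fun B => coupledBlockGen_comp_fst B g) t f x

theorem expect_couplingGen_snd (N k : ℕ) (δ : ℕ → ℝ) (t : ℝ) (f : Equiv.Perm (Fin N) → ℝ)
    (x : Equiv.Perm (Fin N) × Equiv.Perm (Fin N)) :
    expect (couplingGen N k δ) t (fun y => f y.2) x = expect (shuffleGen N k δ) t f x.2 :=
  expect_comp (couplingGen_isLinearMap N k δ) (shuffleGen_isLinearMap N k δ) Prod.snd
    (fun g => blockDynamics_comp fun B => coupledBlockGen_comp_snd B g) t f x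

theorem fstMarginal_couplingLaw (N k : ℕ) (δ : ℕ → ℝ) (t : ℝ) (σ σ' : Equiv.Perm (Fin N)) :
    fstMarginal (couplingLaw N k δ t σ σ') = shuffleLaw N k δ t σ := by
  ext η
  have h := expect_couplingGen_fst N k δ t (Pi.single η 1) (σ, σ')
  rw [← lawAt_eq_expect] at h
  rw [shuffleLaw, ← h, expect, Fintype.sum_prod_type, Finset.sum_eq_single η]
  · simp [fstMarginal, couplingLaw]
  · intro b _ hb
    simp [hb]
  · simp

theorem sndMarginal_couplingLaw (N k : ℕ) (δ : ℕ → ℝ) (t : ℝ) (σ σ' : Equiv.Perm (Fin N)) :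
    sndMarginal (couplingLaw N k δ t σ σ') = shuffleLaw N k δ t σ' := by
  ext η
  have h := expect_couplingGen_snd N k δ t (Pi.single η 1) (σ, σ')
  rw [← lawAt_eq_expect] at h
  rw [shuffleLaw, ← h, expect, Fintype.sum_prod_type_right, Finset.sum_eq_single η]
  · simp [sndMarginal, couplingLaw]
  · intro b _ hb
    simp [hb]
  · simp

theorem couplingLaw_nonneg {k : ℕ} {δ : ℕ → ℝ} (hδ : ∀ i ∈ Finset.Icc 2 (k - 1), 0 ≤ δ i) {t : ℝ}
    (ht : 0 ≤ t) (σ σ' : Equiv.Perm (Fin N)) (y : Equiv.Perm (Fin N) × Equiv.Perm (Fin N)) :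
    0 ≤ couplingLaw N k δ t σ σ' y := by
  refine lawAt_nonneg (fun x y hxy => blockDynamics_nonneg hδ fun B => ?_) ht _ _
  refine mul_nonneg (by positivity) (Finset.sum_nonneg fun z _ => ?_)
  rw [Pi.single_eq_of_ne (Ne.symm hxy), sub_zero, Pi.single_apply]
  split_ifs <;> norm_num

theorem symm_mem_of_eq_off {η η' : Equiv.Perm (Fin N)} (h : ∀ m, m ∉ B → η' m = η m) {ℓ : Fin N}
    (hl : η.symm ℓ ∈ B) : η'.symm ℓ ∈ B := by
  by_contra h2
  have := h _ h2
  rw [Equiv.apply_symm_apply] at this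
  rw [this, Equiv.symm_apply_apply] at hl
  exact h2 hl

theorem symm_eq_of_eq_off {η η' : Equiv.Perm (Fin N)} (h : ∀ m, m ∉ B → η' m = η m) {ℓ : Fin N}
    (hl : η.symm ℓ ∉ B) : η'.symm ℓ = η.symm ℓ := by
  rw [Equiv.symm_apply_eq, h _ hl, Equiv.apply_symm_apply]

theorem mem_block {a l : ℕ} {m : Fin N} : m ∈ block N a l ↔ a ≤ (m : ℕ) ∧ (m : ℕ) < a + l := by
  simp [block]

/-- Coupled updates of an interval preserve the order of the two positions of a card: either both
copies are in the interval and merge, or a copy moving alone cannot jump over the other one. -/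
theorem symm_le_symm_of_mem_coupledOutcomes {a l : ℕ}
    {x y : Equiv.Perm (Fin N) × Equiv.Perm (Fin N)} (hy : y ∈ coupledOutcomes (block N a l) x)
    {ℓ : Fin N} : (x.1.symm ℓ ≤ x.2.symm ℓ → y.1.symm ℓ ≤ y.2.symm ℓ) ∧
      (x.2.symm ℓ ≤ x.1.symm ℓ → y.2.symm ℓ ≤ y.1.symm ℓ) := by
  simp only [coupledOutcomes, Finset.mem_filter, Finset.mem_univ, true_and] at hy
  obtain ⟨h1, h2, h3⟩ := hy
  by_cases m1 : x.1.symm ℓ ∈ block N a l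
  · by_cases m2 : x.2.symm ℓ ∈ block N a l
    · rw [h3 ℓ m1 m2]
      simp
    · have m1' := symm_mem_of_eq_off h1 m1
      rw [symm_eq_of_eq_off h2 m2]
      rw [mem_block] at m1 m2 m1'
      simp only [Fin.le_def]
      omega
  · rw [symm_eq_of_eq_off h1 m1]
    by_cases m2 : x.2.symm ℓ ∈ block N a l
    · have m2' := symm_mem_of_eq_off h2 m2
      rw [mem_block] at m1 m2 m2'
      simp only [Fin.le_def]
      omega
    · rw [symm_eq_of_eq_off h2 m2]
      simp

theorem couplingGen_single_eq_zero {k : ℕ} {δ : ℕ → ℝ}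
    {A : Set (Equiv.Perm (Fin N) × Equiv.Perm (Fin N))}
    (hA : ∀ x ∈ A, ∀ a l, ∀ y ∈ coupledOutcomes (block N a l) x, y ∈ A) :
    ∀ x ∈ A, ∀ y ∉ A, couplingGen N k δ (Pi.single y 1) x = 0 := by
  intro x hx y hy
  refine blockDynamics_eq_zero fun a l => ?_
  rw [coupledBlockGen, Finset.sum_eq_zero, mul_zero]
  intro z hz
  have h1 : z ≠ y := fun h => hy (h ▸ hA x hx a l z hz)
  have h2 : x ≠ y := fun h => hy (h ▸ hx)
  simp [h1, h2]

/-- As the order of the two copies of a card is preserved, the expected distance between them is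
the distance between their expected positions, which only involves the motion of one card. -/
theorem sum_couplingLaw_abs_sub_le (k : ℕ) (δ : ℕ → ℝ) (t : ℝ) (σ σ' : Equiv.Perm (Fin N))
    (ℓ : Fin N) :
    ∑ y, couplingLaw N k δ t σ σ' y * |((y.1.symm ℓ : ℕ) : ℝ) - ((y.2.symm ℓ : ℕ) : ℝ)| ≤
      |expect (cardGen N k δ) t (fun m => ((m : ℕ) : ℝ)) (σ.symm ℓ) -
        expect (cardGen N k δ) t (fun m => ((m : ℕ) : ℝ)) (σ'.symm ℓ)| := by
  have h : ∑ y, couplingLaw N k δ t σ σ' y *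
      (((y.1.symm ℓ : ℕ) : ℝ) - ((y.2.symm ℓ : ℕ) : ℝ)) =
        expect (cardGen N k δ) t (fun m => ((m : ℕ) : ℝ)) (σ.symm ℓ) -
          expect (cardGen N k δ) t (fun m => ((m : ℕ) : ℝ)) (σ'.symm ℓ) := by
    have h1 := expect_couplingGen_fst N k δ t (fun η => ((η.symm ℓ : ℕ) : ℝ)) (σ, σ')
    have h2 := expect_couplingGen_snd N k δ t (fun η => ((η.symm ℓ : ℕ) : ℝ)) (σ, σ')
    rw [expect_shuffleGen_comp_symm N k δ t ℓ (fun m => ((m : ℕ) : ℝ))] at h1 h2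
    rw [← h1, ← h2, expect, expect, ← Finset.sum_sub_distrib]
    exact Finset.sum_congr rfl fun y _ => mul_sub _ _ _
  rw [← h]
  rcases le_total (σ.symm ℓ) (σ'.symm ℓ) with hle | hle
  · rw [← abs_neg, ← Finset.sum_neg_distrib]
    refine le_trans (le_of_eq (Finset.sum_congr rfl fun y _ => ?_)) (le_abs_self _)
    by_cases hy : y.1.symm ℓ ≤ y.2.symm ℓ
    · have : ((y.1.symm ℓ : ℕ) : ℝ) ≤ ((y.2.symm ℓ : ℕ) : ℝ) := by exact_mod_cast hy
      rw [abs_of_nonpos (by linarith)]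
      ring
    · have : couplingLaw N k δ t σ σ' y = 0 :=
        lawAt_eq_zero_of_closed (A := {x | x.1.symm ℓ ≤ x.2.symm ℓ}) (couplingGen_isLinearMap N k δ)
          (couplingGen_single_eq_zero fun x hx a l y hy =>
            (symm_le_symm_of_mem_coupledOutcomes hy).1 hx) t hle hy
      simp [this]
  · refine le_trans (le_of_eq (Finset.sum_congr rfl fun y _ => ?_)) (le_abs_self _)
    by_cases hy : y.2.symm ℓ ≤ y.1.symm ℓ
    · have : ((y.2.symm ℓ : ℕ) : ℝ) ≤ ((y.1.symm ℓ : ℕ) : ℝ) := by exact_mod_cast hy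
      rw [abs_of_nonneg (by linarith)]
    · have : couplingLaw N k δ t σ σ' y = 0 :=
        lawAt_eq_zero_of_closed (A := {x | x.2.symm ℓ ≤ x.1.symm ℓ}) (couplingGen_isLinearMap N k δ)
          (couplingGen_single_eq_zero fun x hx a l y hy =>
            (symm_le_symm_of_mem_coupledOutcomes hy).2 hx) t hle hy
      simp [this]

end SkShuffle

namespace SkShuffle

/-! ### Sums of squared deviations -/

section Variation

variable {α β : Type*}

/-- The sum of the squared deviations of `f` from its average over the finite set `s`. -/
noncomputable def variation (s : Finset α) (f : α → ℝ) : ℝ := ∑ x ∈ s, (f x - avg s f) ^ 2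

theorem variation_nonneg (s : Finset α) (f : α → ℝ) : 0 ≤ variation s f :=
  Finset.sum_nonneg fun _ _ => sq_nonneg _

theorem card_mul_avg (s : Finset α) (f : α → ℝ) : (s.card : ℝ) * avg s f = ∑ x ∈ s, f x := by
  rcases s.eq_empty_or_nonempty with rfl | hs
  · simp
  · have : (s.card : ℝ) ≠ 0 := by exact_mod_cast hs.card_pos.ne'
    rw [avg]
    field_simp

theorem sum_sq_sub_const (s : Finset α) (f : α → ℝ) (c : ℝ) :
    ∑ x ∈ s, (f x - c) ^ 2 = variation s f + s.card * (avg s f - c) ^ 2 := by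
  have h := card_mul_avg s f
  have h1 : ∀ x ∈ s, (f x - c) ^ 2 = (f x - avg s f) ^ 2 +
      (2 * (avg s f - c) * (f x - avg s f) + (avg s f - c) ^ 2) := fun x _ => by ring
  rw [Finset.sum_congr rfl h1, Finset.sum_add_distrib, Finset.sum_add_distrib, ← Finset.mul_sum,
    Finset.sum_sub_distrib, ← h]
  simp [variation]

theorem variation_le_sum_sq_sub (s : Finset α) (f : α → ℝ) (c : ℝ) :
    variation s f ≤ ∑ x ∈ s, (f x - c) ^ 2 := by
  rw [sum_sq_sub_const]
  have : (0 : ℝ) ≤ s.card * (avg s f - c) ^ 2 := by positivity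
  linarith

theorem variation_mono {s t : Finset α} (h : s ⊆ t) (f : α → ℝ) : variation s f ≤ variation t f :=
  (variation_le_sum_sq_sub s f (avg t f)).trans
    (Finset.sum_le_sum_of_subset_of_nonneg h fun _ _ _ => sq_nonneg _)

theorem variation_eq_zero_of_card_le_one {s : Finset α} (h : s.card ≤ 1) (f : α → ℝ) :
    variation s f = 0 := by
  rcases Nat.le_one_iff_eq_zero_or_eq_one.mp h with h | h
  · rw [Finset.card_eq_zero.mp h]; rfl
  · obtain ⟨a, rfl⟩ := Finset.card_eq_one.mp h
    simp [variation, avg]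

theorem variation_map (e : α ↪ β) (s : Finset α) (f : β → ℝ) :
    variation (s.map e) f = variation s (f ∘ e) := by
  simp [variation, avg]

theorem card_inter_mul_avg_sub_sq_le [DecidableEq α] (s t : Finset α) (f : α → ℝ) :
    ((s ∩ t).card : ℝ) * (avg s f - avg t f) ^ 2 ≤ 2 * (variation s f + variation t f) := by
  calc ((s ∩ t).card : ℝ) * (avg s f - avg t f) ^ 2
      = ∑ x ∈ s ∩ t, (avg s f - avg t f) ^ 2 := by simp
    _ ≤ ∑ x ∈ s ∩ t, (2 * (f x - avg s f) ^ 2 + 2 * (f x - avg t f) ^ 2) := by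
        refine Finset.sum_le_sum fun x _ => ?_
        nlinarith [sq_nonneg ((f x - avg s f) + (f x - avg t f))]
    _ = 2 * ∑ x ∈ s ∩ t, (f x - avg s f) ^ 2 + 2 * ∑ x ∈ s ∩ t, (f x - avg t f) ^ 2 := by
        rw [Finset.sum_add_distrib, Finset.mul_sum, Finset.mul_sum]
    _ ≤ 2 * variation s f + 2 * variation t f := by
        gcongr
        · exact Finset.sum_le_sum_of_subset_of_nonneg Finset.inter_subset_left
            fun _ _ _ => sq_nonneg _
        · exact Finset.sum_le_sum_of_subset_of_nonneg Finset.inter_subset_right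
            fun _ _ _ => sq_nonneg _
    _ = _ := by ring

/-- Near an end of the deck the weights `w` degenerate, but a weighted bound on the deviations from
`c` together with the variation controls the unweighted deviations. -/
theorem sum_sq_sub_le_of_weighted {s : Finset α} {f w : α → ℝ} {c S h : ℝ} (hh : 0 < h)
    (hcard : (s.card : ℝ) = h) (hw0 : ∀ x ∈ s, 0 ≤ w x) (hwh : ∀ x ∈ s, w x ≤ h)
    (hws : h ^ 2 / 2 ≤ ∑ x ∈ s, w x) (hS : ∑ x ∈ s, w x * (f x - c) ^ 2 ≤ S) :
    ∑ x ∈ s, (f x - c) ^ 2 ≤ 5 * variation s f + 4 * S / h := by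
  have h1 : (∑ x ∈ s, w x) * (avg s f - c) ^ 2 ≤ 2 * h * variation s f + 2 * S := by
    calc (∑ x ∈ s, w x) * (avg s f - c) ^ 2
        = ∑ x ∈ s, w x * (avg s f - c) ^ 2 := by rw [Finset.sum_mul]
      _ ≤ ∑ x ∈ s, (2 * h * (f x - avg s f) ^ 2 + 2 * (w x * (f x - c) ^ 2)) := by
          refine Finset.sum_le_sum fun x hx => ?_
          have h2 : (avg s f - c) ^ 2 ≤ 2 * (f x - avg s f) ^ 2 + 2 * (f x - c) ^ 2 := by
            nlinarith [sq_nonneg ((f x - avg s f) + (f x - c))]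
          have h3 := mul_le_mul_of_nonneg_left h2 (hw0 x hx)
          have h4 := mul_le_mul_of_nonneg_right (hwh x hx) (sq_nonneg (f x - avg s f))
          linarith
      _ = 2 * h * variation s f + 2 * ∑ x ∈ s, w x * (f x - c) ^ 2 := by
          rw [Finset.sum_add_distrib, variation, Finset.mul_sum, Finset.mul_sum]
      _ ≤ _ := by linarith
  have h2 := mul_le_mul_of_nonneg_right hws (sq_nonneg (avg s f - c))
  rw [sum_sq_sub_const, hcard]
  have h3 : h * (avg s f - c) ^ 2 ≤ 4 * variation s f + 4 * S / h := by
    have h5 : h * (h * (avg s f - c) ^ 2) ≤ h * (4 * variation s f + 4 * S / h) := by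
      have : h * (4 * S / h) = 4 * S := by field_simp
      rw [mul_add, this]
      linarith
    exact le_of_mul_le_mul_left h5 hh
  linarith

end Variation

/-! ### A Poincaré inequality for sliding blocks -/

theorem card_filter_mod_le {n h M : ℕ} (hnM : n ≤ M * h) (r : ℕ) :
    ((Finset.range n).filter fun a => a % h = r).card ≤ M := by
  refine le_trans (Finset.card_le_card_of_injOn (fun a => a / h) (t := Finset.range M) ?_ ?_)
    (by simp)
  · intro a ha
    simp only [Finset.coe_filter, Finset.mem_range, Set.mem_ofPred_eq] at ha
    simp only [Finset.coe_range, Set.mem_Iio]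
    exact Nat.div_lt_of_lt_mul (by rw [mul_comm]; omega)
  · intro a ha b hb hab
    simp only [Finset.coe_filter, Finset.mem_range, Set.mem_ofPred_eq] at ha hb
    simp only at hab
    rw [← Nat.div_add_mod a h, ← Nat.div_add_mod b h, hab, ha.2, hb.2]

/-- Chaining: a sequence whose increments over distances at most `h` are controlled by a weight `W`
is close to a constant. One moves along a residue class modulo `h` to its first element, and then
compares the first elements with one another. -/
theorem exists_sum_sq_sub_le {n h M : ℕ} (hh : 0 < h) (hhn : h ≤ n) (hnM : n ≤ M * h)
    {c W : ℕ → ℝ} {D : ℝ} (hD : 0 ≤ D) (hW : ∀ a, 0 ≤ W a)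
    (hc : ∀ a b, a ≤ b → b < n → b ≤ a + h → (c b - c a) ^ 2 ≤ D * (W a + W b)) :
    ∃ c₀ : ℝ, ∑ a ∈ Finset.range n, (c a - c₀) ^ 2 ≤
      8 * D * (M : ℝ) ^ 2 * ∑ a ∈ Finset.range n, W a := by
  set T := ∑ a ∈ Finset.range n, W a with hT
  have hT0 : 0 ≤ T := Finset.sum_nonneg fun a _ => hW a
  have hM : (1 : ℝ) ≤ M := by
    have : M ≠ 0 := by rintro rfl; omega
    exact_mod_cast Nat.one_le_iff_ne_zero.mpr this
  have hmod : ∀ a ∈ Finset.range n, a % h ∈ Finset.range h := fun a _ =>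
    Finset.mem_range.mpr (Nat.mod_lt _ hh)
  -- the total weight of a residue class
  set ω : ℕ → ℝ := fun r => ∑ a ∈ (Finset.range n).filter (fun a => a % h = r), W a with hω
  have hω0 : ∀ r, 0 ≤ ω r := fun r => Finset.sum_nonneg fun a _ => hW a
  have hωsum : ∑ r ∈ Finset.range h, ω r = T := Finset.sum_fiberwise_of_maps_to hmod W
  -- a function of the residue is summed at most `M` times
  have hfib : ∀ F : ℕ → ℝ, (∀ r, 0 ≤ F r) →
      ∑ a ∈ Finset.range n, F (a % h) ≤ M * ∑ r ∈ Finset.range h, F r := by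
    intro F hF
    rw [← Finset.sum_fiberwise_of_maps_to hmod, Finset.mul_sum]
    refine Finset.sum_le_sum fun r _ => ?_
    have : ∑ a ∈ (Finset.range n).filter (fun a => a % h = r), F (a % h) =
        (((Finset.range n).filter fun a => a % h = r).card : ℝ) * F r := by
      rw [Finset.sum_congr rfl fun a ha => by rw [(Finset.mem_filter.mp ha).2]]
      simp
    rw [this]
    exact mul_le_mul_of_nonneg_right (by exact_mod_cast card_filter_mod_le hnM r) (hF r)
  have hchain : ∀ a ∈ Finset.range n, (c a - c (a % h)) ^ 2 ≤ 2 * D * M * ω (a % h) := by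
    intro a ha
    have han := Finset.mem_range.mp ha
    set r := a % h with hr
    set i := a / h with hi
    have hari : a = r + i * h := by rw [hr, hi, mul_comm]; exact (Nat.mod_add_div a h).symm
    have hiM : (i : ℝ) ≤ M := by
      have : i < M := Nat.div_lt_of_lt_mul (by rw [mul_comm]; omega)
      exact_mod_cast this.le
    have htel : c a - c r = ∑ j ∈ Finset.range i, (c (r + (j + 1) * h) - c (r + j * h)) := by
      rw [Finset.sum_range_sub (fun j => c (r + j * h)), ← hari]
      simp
    have hlt : ∀ j < i + 1, r + j * h < n := by
      intro j hj
      have : j * h ≤ i * h := Nat.mul_le_mul_right h (by omega)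
      omega
    have hsub : ∀ s : ℕ, s ≤ 1 → ∑ j ∈ Finset.range i, W (r + (j + s) * h) ≤ ω r := by
      intro s hs
      have hinj : Set.InjOn (fun j => r + (j + s) * h) (Finset.range i : Set ℕ) := by
        intro j _ j' _ hjj
        simp only [add_right_inj] at hjj
        have := Nat.eq_of_mul_eq_mul_right hh hjj
        omega
      rw [← Finset.sum_image (f := W) hinj]
      refine Finset.sum_le_sum_of_subset_of_nonneg ?_ fun _ _ _ => hW _
      intro b hb
      obtain ⟨j, hj, rfl⟩ := Finset.mem_image.mp hb
      have := Finset.mem_range.mp hj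
      refine Finset.mem_filter.mpr ⟨Finset.mem_range.mpr (hlt _ (by omega)), ?_⟩
      rw [Nat.add_mul_mod_self_right, hr, Nat.mod_mod]
    calc (c a - c r) ^ 2
        ≤ i * ∑ j ∈ Finset.range i, (c (r + (j + 1) * h) - c (r + j * h)) ^ 2 := by
          rw [htel]
          simpa using sq_sum_le_card_mul_sum_sq (s := Finset.range i)
            (f := fun j => c (r + (j + 1) * h) - c (r + j * h))
      _ ≤ M * ∑ j ∈ Finset.range i, D * (W (r + (j + 0) * h) + W (r + (j + 1) * h)) := by
          refine mul_le_mul hiM (Finset.sum_le_sum fun j hj => ?_)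
            (Finset.sum_nonneg fun _ _ => sq_nonneg _) (by positivity)
          have hj' := Finset.mem_range.mp hj
          have e : (j + 1) * h = j * h + h := by ring
          exact hc _ _ (by rw [e]; omega) (hlt _ (by omega)) (by rw [e]; omega)
      _ ≤ M * (D * (ω r + ω r)) := by
          rw [← Finset.mul_sum, Finset.sum_add_distrib]
          have h0 := hsub 0 (by omega)
          have h1 := hsub 1 le_rfl
          gcongr
      _ = 2 * D * M * ω r := by ring
  set c₀ := avg (Finset.range h) c with hc₀
  have hroot : ∑ r ∈ Finset.range h, (c r - c₀) ^ 2 ≤ 2 * D * T := by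
    have hhR : (0 : ℝ) < h := by exact_mod_cast hh
    have hmean : (h : ℝ) * c₀ = ∑ r ∈ Finset.range h, c r := by
      simpa using card_mul_avg (Finset.range h) c
    have h1 : ∀ r ∈ Finset.range h, h * (c r - c₀) ^ 2 ≤
        ∑ r' ∈ Finset.range h, D * (W r + W r') := by
      intro r hr
      have h2 : ∑ r' ∈ Finset.range h, (c r' - c r) ^ 2 =
          variation (Finset.range h) c + h * (c₀ - c r) ^ 2 := by
        simpa using sum_sq_sub_const (Finset.range h) c (c r)
      have h3 := variation_nonneg (Finset.range h) c
      have h4 : ∑ r' ∈ Finset.range h, (c r' - c r) ^ 2 ≤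
          ∑ r' ∈ Finset.range h, D * (W r + W r') := by
        refine Finset.sum_le_sum fun r' hr' => ?_
        rw [Finset.mem_range] at hr hr'
        rcases le_total r r' with hle | hle
        · exact hc r r' hle (by omega) (by omega)
        · have := hc r' r hle (by omega) (by omega)
          rw [add_comm (W r), ← neg_sub (c r), neg_sq]
          exact this
      have h5 : (c r - c₀) ^ 2 = (c₀ - c r) ^ 2 := by ring
      rw [h5]
      linarith
    have h2 := Finset.sum_le_sum h1
    have h3 : ∑ r ∈ Finset.range h, ∑ r' ∈ Finset.range h, D * (W r + W r') =
        h * (2 * D * ∑ r ∈ Finset.range h, W r) := by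
      simp only [← Finset.mul_sum, Finset.sum_add_distrib, Finset.sum_const, Finset.card_range,
        nsmul_eq_mul]
      ring
    rw [h3, ← Finset.mul_sum] at h2
    have h4 := le_of_mul_le_mul_left h2 hhR
    have h5 : ∑ r ∈ Finset.range h, W r ≤ T :=
      Finset.sum_le_sum_of_subset_of_nonneg (Finset.range_mono hhn) fun _ _ _ => hW _
    exact h4.trans (by gcongr)
  refine ⟨c₀, ?_⟩
  calc ∑ a ∈ Finset.range n, (c a - c₀) ^ 2
      ≤ ∑ a ∈ Finset.range n, (2 * (2 * D * M * ω (a % h)) + 2 * (c (a % h) - c₀) ^ 2) := by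
        refine Finset.sum_le_sum fun a ha => ?_
        have := hchain a ha
        nlinarith [sq_nonneg ((c a - c (a % h)) - (c (a % h) - c₀))]
    _ ≤ 2 * (2 * D * M * (M * T)) + 2 * (M * (2 * D * T)) := by
        rw [Finset.sum_add_distrib, ← Finset.mul_sum, ← Finset.mul_sum, ← Finset.mul_sum]
        have h1 := hfib ω hω0
        have h2 := hfib (fun r => (c r - c₀) ^ 2) fun r => sq_nonneg _
        rw [hωsum] at h1
        have h3 := h2.trans (mul_le_mul_of_nonneg_left hroot (by positivity))
        gcongr
    _ ≤ 8 * D * (M : ℝ) ^ 2 * T := by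
        have : (M : ℝ) ≤ M ^ 2 := by nlinarith
        have : (M : ℝ) * (D * T) ≤ M ^ 2 * (D * T) := by gcongr
        linarith

/-- Variation over the deck in terms of the variations over all blocks of length `k` and over the
two end segments, where few blocks are available. -/
theorem variation_range_le {N k : ℕ} (hk : 2 ≤ k) (hkN : 2 * k ≤ N) (f : ℕ → ℝ) :
    variation (Finset.range N) f ≤
      5 * (variation (Finset.Ico 0 (k / 2)) f + variation (Finset.Ico (N - k / 2) N) f) +
        33000 * ((N : ℝ) ^ 2 / (k : ℝ) ^ 3) *
          ∑ a ∈ Finset.range (N - k + 1), variation (Finset.Ico a (a + k)) f := by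
  set h := k / 2 with hh
  set n := N - k + 1 with hn
  set V : ℕ → ℝ := fun a => variation (Finset.Ico a (a + k)) f with hV
  set E := ∑ a ∈ Finset.range n, V a with hE
  have hV0 : ∀ a, 0 ≤ V a := fun a => variation_nonneg _ _
  have hE0 : 0 ≤ E := Finset.sum_nonneg fun a _ => hV0 a
  have h1 : 1 ≤ h := by omega
  have hkR : (2 : ℝ) ≤ k := by exact_mod_cast hk
  have hhR : (k : ℝ) / 3 ≤ h := by
    have : k ≤ 3 * h := by omega
    have : (k : ℝ) ≤ 3 * h := by exact_mod_cast this
    linarith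
  have hhpos : (0 : ℝ) < h := by linarith
  have hkN' : (k : ℝ) ≤ N := by
    have : k ≤ N := by omega
    exact_mod_cast this
  set M := N / h + 1 with hM
  have hMR : (M : ℝ) ≤ 6 * N / k := by
    have h2 : ((N / h : ℕ) : ℝ) ≤ (N : ℝ) / h := Nat.cast_div_le
    have h3 : (N : ℝ) / h ≤ N / (k / 3) := by gcongr
    have h4 : (N : ℝ) / (k / 3) = 3 * N / k := by field_simp
    have h5 : 1 ≤ (N : ℝ) / k := by rw [le_div_iff₀ (by linarith)]; linarith
    have h6 : 6 * (N : ℝ) / k = 3 * N / k + 3 * (N / k) := by ring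
    push_cast [hM]
    rw [h6]
    linarith
  have hnM : n ≤ M * h := by
    have := Nat.lt_div_mul_add (a := N) (b := h) (by omega)
    have e : M * h = N / h * h + h := by rw [hM]; ring
    omega
  obtain ⟨c, hc⟩ := exists_sum_sq_sub_le (c := fun a => avg (Finset.Ico a (a + k)) f) (W := V)
    (D := 4 / k) (n := n) (h := h) (M := M) (by omega) (by omega) hnM (by positivity) hV0 (by
      intro a b hab _ hbh
      have h2 := card_inter_mul_avg_sub_sq_le (Finset.Ico b (b + k)) (Finset.Ico a (a + k)) f
      rw [Finset.Ico_inter_Ico, Nat.card_Ico] at h2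
      have h3 : (k : ℝ) / 2 ≤ ((min (b + k) (a + k) - max b a : ℕ) : ℝ) := by
        have : k ≤ 2 * (min (b + k) (a + k) - max b a) := by omega
        have : (k : ℝ) ≤ 2 * ((min (b + k) (a + k) - max b a : ℕ) : ℝ) := by exact_mod_cast this
        linarith
      have h4 := mul_le_mul_of_nonneg_right h3 (sq_nonneg
        (avg (Finset.Ico b (b + k)) f - avg (Finset.Ico a (a + k)) f))
      rw [div_mul_eq_mul_div, le_div_iff₀ (by linarith)]
      simp only [hV]
      linarith)
  -- deviations from `c`, each position being counted once for every block that contains it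
  set S := ∑ a ∈ Finset.range n, ∑ x ∈ Finset.Ico a (a + k), (f x - c) ^ 2 with hS
  have hSE : S ≤ 1189 * ((N : ℝ) ^ 2 / (k : ℝ) ^ 2) * E := by
    have e : S = E + k * ∑ a ∈ Finset.range n, (avg (Finset.Ico a (a + k)) f - c) ^ 2 := by
      rw [hS, Finset.sum_congr rfl fun a _ => sum_sq_sub_const (Finset.Ico a (a + k)) f c,
        Finset.sum_add_distrib, Finset.mul_sum]
      simp [hE, hV]
    have h2 : (k : ℝ) * ∑ a ∈ Finset.range n, (avg (Finset.Ico a (a + k)) f - c) ^ 2 ≤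
        32 * (M : ℝ) ^ 2 * E := by
      refine (mul_le_mul_of_nonneg_left hc (by linarith)).trans (le_of_eq ?_)
      field_simp
      ring
    have h3 : (M : ℝ) ^ 2 ≤ (6 * N / k) ^ 2 := by gcongr
    have h4 : (1 : ℝ) ≤ (N : ℝ) ^ 2 / (k : ℝ) ^ 2 := by
      rw [le_div_iff₀ (by positivity)]
      nlinarith
    have h5 : (6 * (N : ℝ) / k) ^ 2 = 36 * ((N : ℝ) ^ 2 / (k : ℝ) ^ 2) := by ring
    rw [h5] at h3
    rw [e]
    nlinarith [mul_le_mul_of_nonneg_right h3 hE0, mul_le_mul_of_nonneg_right h4 hE0]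
  have hcount : ∀ (s : Finset ℕ) (w : ℕ → ℕ),
      (∀ x ∈ s, x < N) → (∀ x ∈ s, w x ≤ min (x + 1) n - (x + 1 - k)) →
      ∑ x ∈ s, (w x : ℝ) * (f x - c) ^ 2 ≤ S := by
    intro s w hsN hw
    have e : S = ∑ x ∈ Finset.range N, ∑ a ∈ Finset.Ico (x + 1 - k) (min (x + 1) n),
        (f x - c) ^ 2 := by
      refine Finset.sum_comm' fun a x => ?_
      simp only [Finset.mem_range, Finset.mem_Ico]
      omega
    rw [e]
    calc ∑ x ∈ s, (w x : ℝ) * (f x - c) ^ 2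
        ≤ ∑ x ∈ s, ∑ a ∈ Finset.Ico (x + 1 - k) (min (x + 1) n), (f x - c) ^ 2 := by
          refine Finset.sum_le_sum fun x hx => ?_
          rw [Finset.sum_const, Nat.card_Ico, nsmul_eq_mul]
          exact mul_le_mul_of_nonneg_right (by exact_mod_cast hw x hx) (sq_nonneg _)
      _ ≤ _ := by
          refine Finset.sum_le_sum_of_subset_of_nonneg
            (fun x hx => Finset.mem_range.mpr (hsN x hx)) fun x _ _ => ?_
          exact Finset.sum_nonneg fun _ _ => sq_nonneg _
  have hmid : ∑ x ∈ Finset.Ico h (N - h), (f x - c) ^ 2 ≤ S / h := by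
    have := hcount (Finset.Ico h (N - h)) (fun _ => h)
      (fun x hx => by rw [Finset.mem_Ico] at hx; omega)
      (fun x hx => by rw [Finset.mem_Ico] at hx; omega)
    rw [← Finset.mul_sum] at this
    rw [le_div_iff₀ hhpos]
    linarith
  have hgauss : ∑ i ∈ Finset.range h, ((i : ℝ) + 1) = h * (h + 1) / 2 := by
    clear_value h
    clear * -
    induction h with
    | zero => simp
    | succ m ih => rw [Finset.sum_range_succ, ih]; push_cast; ring
  have hleft : ∑ x ∈ Finset.Ico 0 h, (f x - c) ^ 2 ≤
      5 * variation (Finset.Ico 0 h) f + 4 * S / h := by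
    refine sum_sq_sub_le_of_weighted (w := fun x => ((x + 1 : ℕ) : ℝ)) hhpos (by simp)
      (fun x _ => by positivity) ?_ ?_ (hcount _ _ ?_ ?_)
    · intro x hx
      rw [Finset.mem_Ico] at hx
      exact_mod_cast hx.2
    · push_cast
      rw [← Finset.range_eq_Ico, hgauss]
      nlinarith
    · intro x hx
      rw [Finset.mem_Ico] at hx
      omega
    · intro x hx
      rw [Finset.mem_Ico] at hx
      omega
  have hright : ∑ x ∈ Finset.Ico (N - h) N, (f x - c) ^ 2 ≤
      5 * variation (Finset.Ico (N - h) N) f + 4 * S / h := by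
    refine sum_sq_sub_le_of_weighted (w := fun x => ((N - x : ℕ) : ℝ)) hhpos ?_
      (fun x _ => by positivity) ?_ ?_ (hcount _ _ ?_ ?_)
    · rw [Nat.card_Ico]
      congr 1
      omega
    · intro x hx
      rw [Finset.mem_Ico] at hx
      have : N - x ≤ h := by omega
      exact_mod_cast this
    · rw [Finset.sum_Ico_eq_sum_range]
      have e : N - (N - h) = h := by omega
      rw [e, ← Finset.sum_range_reflect]
      rw [Finset.sum_congr rfl (g := fun i : ℕ => (i : ℝ) + 1), hgauss]
      · nlinarith
      · intro i hi
        rw [Finset.mem_range] at hi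
        have : N - (N - h + (h - 1 - i)) = i + 1 := by omega
        rw [this]
        push_cast
        rfl
    · intro x hx
      rw [Finset.mem_Ico] at hx
      omega
    · intro x hx
      rw [Finset.mem_Ico] at hx
      omega
  have hsplit : ∑ x ∈ Finset.range N, (f x - c) ^ 2 = ∑ x ∈ Finset.Ico 0 h, (f x - c) ^ 2 +
      ∑ x ∈ Finset.Ico h (N - h), (f x - c) ^ 2 + ∑ x ∈ Finset.Ico (N - h) N, (f x - c) ^ 2 := by
    rw [Finset.sum_Ico_consecutive _ (by omega) (by omega),
      Finset.sum_Ico_consecutive _ (by omega) (by omega), Finset.range_eq_Ico]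
  have hSh : S / h ≤ 3567 * ((N : ℝ) ^ 2 / (k : ℝ) ^ 3) * E := by
    have h2 : S / h ≤ 1189 * ((N : ℝ) ^ 2 / (k : ℝ) ^ 2) * E / (k / 3) := by gcongr
    refine h2.trans (le_of_eq ?_)
    field_simp
    ring
  have hfin := variation_le_sum_sq_sub (Finset.range N) f c
  rw [hsplit] at hfin
  have h9 : 4 * S / h = 4 * (S / h) := by ring
  have h10 : 0 ≤ ((N : ℝ) ^ 2 / (k : ℝ) ^ 3) * E := by positivity
  rw [h9] at hleft hright
  linarith

end SkShuffle

namespace SkShuffle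

/-! ### Spectral gap of the motion of a single card -/

section CardChain

variable {N k : ℕ} {δ : ℕ → ℝ}

theorem sum_mul_cardBlockGen (B : Finset (Fin N)) (g : Fin N → ℝ) :
    ∑ m, g m * cardBlockGen B g m = -variation B g := by
  have h0 := sum_sq_sub_const B g 0
  have h1 := card_mul_avg B g
  simp only [cardBlockGen, mul_ite, mul_zero, Finset.sum_ite_mem, Finset.univ_inter, mul_sub,
    Finset.sum_sub_distrib, ← Finset.sum_mul, ← h1]
  simp only [sub_zero] at h0
  have h2 : ∑ m ∈ B, g m * g m = ∑ m ∈ B, g m ^ 2 := Finset.sum_congr rfl fun m _ => by ring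
  rw [h2, h0]
  ring

theorem sum_cardBlockGen (B : Finset (Fin N)) (g : Fin N → ℝ) :
    ∑ m, cardBlockGen B g m = 0 := by
  have h1 := card_mul_avg B g
  simp [cardBlockGen, Finset.sum_sub_distrib, h1]

theorem sum_mul_cardGen (w g : Fin N → ℝ) : ∑ m, w m * cardGen N k δ g m =
    ∑ a ∈ Finset.range (N - k + 1), ∑ m, w m * cardBlockGen (block N a k) g m +
      ∑ i ∈ Finset.Icc 2 (k - 1), δ i * (∑ m, w m * cardBlockGen (block N 0 i) g m +
        ∑ m, w m * cardBlockGen (block N (N - i) i) g m) := by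
  simp only [cardGen, blockDynamics, mul_add, Finset.sum_add_distrib, Finset.mul_sum]
  rw [Finset.sum_comm, Finset.sum_comm (s := Finset.univ), Finset.sum_comm (s := Finset.univ)]
  simp only [mul_left_comm]

theorem sum_cardGen (g : Fin N → ℝ) : ∑ m, cardGen N k δ g m = 0 := by
  have := sum_mul_cardGen (k := k) (δ := δ) (fun _ => 1) g
  simpa only [one_mul, sum_cardBlockGen, add_zero, mul_zero, Finset.sum_const_zero] using this

/-- The Dirichlet form of the motion of a single card. -/
noncomputable def cardEnergy (N k : ℕ) (δ : ℕ → ℝ) (g : Fin N → ℝ) : ℝ :=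
  ∑ a ∈ Finset.range (N - k + 1), variation (block N a k) g +
    ∑ i ∈ Finset.Icc 2 (k - 1), δ i * (variation (block N 0 i) g + variation (block N (N - i) i) g)

theorem sum_mul_cardGen_self (g : Fin N → ℝ) :
    ∑ m, g m * cardGen N k δ g m = -cardEnergy N k δ g := by
  rw [sum_mul_cardGen]
  simp only [sum_mul_cardBlockGen, cardEnergy, ← neg_add, mul_neg, Finset.sum_neg_distrib]

theorem cardGen_one : cardGen N k δ (fun _ => 1) = 0 := by
  ext m
  refine blockDynamics_eq_zero fun a l => ?_
  by_cases h : m ∈ block N a l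
  · have : ((block N a l).card : ℝ) ≠ 0 := by exact_mod_cast (Finset.card_pos.mpr ⟨m, h⟩).ne'
    simp [cardBlockGen, h, avg, this]
  · simp [cardBlockGen, h]

theorem sum_variation_block_le_cardEnergy (hδ : ∀ i ∈ Finset.Icc 2 (k - 1), 0 ≤ δ i)
    (g : Fin N → ℝ) :
    ∑ a ∈ Finset.range (N - k + 1), variation (block N a k) g ≤ cardEnergy N k δ g := by
  refine le_add_of_nonneg_right (Finset.sum_nonneg fun i hi => mul_nonneg (hδ i hi) ?_)
  exact add_nonneg (variation_nonneg _ _) (variation_nonneg _ _)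

theorem cardEnergy_nonneg (hδ : ∀ i ∈ Finset.Icc 2 (k - 1), 0 ≤ δ i) (g : Fin N → ℝ) :
    0 ≤ cardEnergy N k δ g :=
  (Finset.sum_nonneg fun _ _ => variation_nonneg _ _).trans
    (sum_variation_block_le_cardEnergy hδ g)

theorem block_subset_block {a l a' l' : ℕ} (h1 : a' ≤ a) (h2 : a + l ≤ a' + l') :
    block N a l ⊆ block N a' l' := by
  intro m hm
  rw [mem_block] at hm ⊢
  omega

theorem variation_Ico_eq_variation_block {a l : ℕ} (h : a + l ≤ N) (f : ℕ → ℝ) :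
    variation (Finset.Ico a (a + l)) f = variation (block N a l) fun m => f m := by
  have : Finset.Ico a (a + l) = (block N a l).map Fin.valEmbedding := by
    ext x
    simp only [Finset.mem_Ico, Finset.mem_map, mem_block, Fin.valEmbedding_apply]
    constructor
    · intro hx
      exact ⟨⟨x, by omega⟩, hx, rfl⟩
    · rintro ⟨m, hm, rfl⟩
      exact hm
  rw [this, variation_map]
  rfl

/-- The variation over the two end segments of length `k / 2`. -/
noncomputable def endVariation (N k : ℕ) (g : Fin N → ℝ) : ℝ :=
  variation (block N 0 (k / 2)) g + variation (block N (N - k / 2) (k / 2)) g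

/-- Poincaré inequality for the motion of a single card, given that the mixing within the two end
segments is not slower than the mixing of the whole deck. -/
theorem variation_univ_le_cardEnergy (hk : 2 ≤ k) (hkN : 2 * k ≤ N)
    (hδ : ∀ i ∈ Finset.Icc 2 (k - 1), 0 ≤ δ i) (g : Fin N → ℝ)
    (hend : endVariation N k g ≤ 2 * ((N : ℝ) ^ 2 / (k : ℝ) ^ 3) * cardEnergy N k δ g) :
    variation Finset.univ g ≤ 33010 * ((N : ℝ) ^ 2 / (k : ℝ) ^ 3) * cardEnergy N k δ g := by
  set f : ℕ → ℝ := fun x => if hx : x < N then g ⟨x, hx⟩ else 0 with hf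
  have hfg : (fun m : Fin N => f m) = g := by
    ext m
    simp [hf]
  have hb : ∀ a l, a + l ≤ N → variation (Finset.Ico a (a + l)) f = variation (block N a l) g := by
    intro a l h
    rw [variation_Ico_eq_variation_block h, hfg]
  have h := variation_range_le hk hkN f
  have hu : variation (Finset.range N) f = variation Finset.univ g := by
    have h1 := hb 0 N (by omega)
    rw [zero_add, ← Finset.range_eq_Ico] at h1
    rw [h1]
    congr 1
    ext m
    simp [mem_block]
  have hl := hb 0 (k / 2) (by omega)
  have hr := hb (N - k / 2) (k / 2) (by omega)
  rw [zero_add] at hl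
  rw [Nat.sub_add_cancel (by omega)] at hr
  rw [hu, hl, hr, Finset.sum_congr rfl fun a ha => hb a k (by
    have := Finset.mem_range.mp ha
    omega)] at h
  have h2 : (0 : ℝ) ≤ (N : ℝ) ^ 2 / (k : ℝ) ^ 3 := by positivity
  have h3 := mul_le_mul_of_nonneg_left (sum_variation_block_le_cardEnergy hδ g) h2
  rw [endVariation] at hend
  linarith

theorem endVariation_le_of_cube_le (hk : 2 ≤ k) (hkN : 2 * k ≤ N) (hcube : (k : ℝ) ^ 3 ≤ (N : ℝ) ^ 2)
    (hδ : ∀ i ∈ Finset.Icc 2 (k - 1), 0 ≤ δ i) (g : Fin N → ℝ) :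
    endVariation N k g ≤ 2 * ((N : ℝ) ^ 2 / (k : ℝ) ^ 3) * cardEnergy N k δ g := by
  have hE := sum_variation_block_le_cardEnergy hδ g
  have hsingle : ∀ a ∈ Finset.range (N - k + 1), variation (block N a k) g ≤ cardEnergy N k δ g :=
    fun a ha => (Finset.single_le_sum (f := fun a => variation (block N a k) g)
      (fun _ _ => variation_nonneg _ _) ha).trans hE
  have hl : variation (block N 0 (k / 2)) g ≤ cardEnergy N k δ g :=
    (variation_mono (block_subset_block le_rfl (by omega)) g).trans (hsingle 0 (by simp))
  have hr : variation (block N (N - k / 2) (k / 2)) g ≤ cardEnergy N k δ g :=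
    (variation_mono (block_subset_block (by omega) (by omega)) g).trans
      (hsingle (N - k) (by simp))
  have h1 : 1 ≤ (N : ℝ) ^ 2 / (k : ℝ) ^ 3 := by
    rw [le_div_iff₀ (by positivity)]
    linarith
  have := mul_le_mul_of_nonneg_right h1 (cardEnergy_nonneg (N := N) hδ g)
  rw [endVariation]
  linarith

/-- If all boundary rates are at least one, each end segment of length `k / 2` is contained in
boundary blocks of total rate at least `k / 2`. -/
theorem endVariation_le_of_one_le (hk : 2 ≤ k) (hkN : 2 * k ≤ N)
    (hδ : ∀ i ∈ Finset.Icc 2 (k - 1), 1 ≤ δ i) (g : Fin N → ℝ) :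
    endVariation N k g ≤ 2 * ((N : ℝ) ^ 2 / (k : ℝ) ^ 3) * cardEnergy N k δ g := by
  have hE0 := cardEnergy_nonneg (N := N) (fun i hi => zero_le_one.trans (hδ i hi)) g
  have hkR : (2 : ℝ) ≤ k := by exact_mod_cast hk
  have hv0 : 0 ≤ endVariation N k g := add_nonneg (variation_nonneg _ _) (variation_nonneg _ _)
  have key : (k : ℝ) / 2 * endVariation N k g ≤ cardEnergy N k δ g := by
    rcases Nat.lt_or_ge (k / 2) 2 with h2 | h2
    · have hcard : ∀ a, (block N a (k / 2)).card ≤ 1 := by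
        intro a
        rw [Finset.card_le_one]
        intro m hm m' hm'
        rw [mem_block] at hm hm'
        exact Fin.ext (by omega)
      rw [endVariation, variation_eq_zero_of_card_le_one (hcard _),
        variation_eq_zero_of_card_le_one (hcard _)]
      simpa using hE0
    · have hterm : ∀ i ∈ Finset.Ico (k / 2) k, endVariation N k g ≤
          δ i * (variation (block N 0 i) g + variation (block N (N - i) i) g) := by
        intro i hi
        rw [Finset.mem_Ico] at hi
        have h3 : endVariation N k g ≤
            variation (block N 0 i) g + variation (block N (N - i) i) g :=
          add_le_add (variation_mono (block_subset_block le_rfl (by omega)) g)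
            (variation_mono (block_subset_block (by omega) (by omega)) g)
        refine h3.trans (le_mul_of_one_le_left (hv0.trans h3) (hδ i ?_))
        rw [Finset.mem_Icc]
        omega
      have hsum := Finset.sum_le_sum hterm
      rw [Finset.sum_const, Nat.card_Ico, nsmul_eq_mul] at hsum
      have hhalf : (k : ℝ) / 2 ≤ ((k - k / 2 : ℕ) : ℝ) := by
        have : k ≤ 2 * (k - k / 2) := by omega
        have : (k : ℝ) ≤ 2 * ((k - k / 2 : ℕ) : ℝ) := by exact_mod_cast this
        linarith
      calc (k : ℝ) / 2 * endVariation N k g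
          ≤ ((k - k / 2 : ℕ) : ℝ) * endVariation N k g := by gcongr
        _ ≤ _ := hsum
        _ ≤ ∑ i ∈ Finset.Icc 2 (k - 1),
            δ i * (variation (block N 0 i) g + variation (block N (N - i) i) g) := by
            refine Finset.sum_le_sum_of_subset_of_nonneg ?_ fun i hi _ => ?_
            · intro i hi
              rw [Finset.mem_Ico] at hi
              rw [Finset.mem_Icc]
              omega
            · exact mul_nonneg (zero_le_one.trans (hδ i hi))
                (add_nonneg (variation_nonneg _ _) (variation_nonneg _ _))
        _ ≤ _ := le_add_of_nonneg_left (Finset.sum_nonneg fun _ _ => variation_nonneg _ _)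
  have hkN' : (k : ℝ) ≤ N := by
    have : k ≤ N := by omega
    exact_mod_cast this
  have h1 : 1 / (k : ℝ) ≤ (N : ℝ) ^ 2 / (k : ℝ) ^ 3 := by
    rw [div_le_div_iff₀ (by positivity) (by positivity)]
    nlinarith [mul_le_mul_of_nonneg_left (pow_le_pow_left₀ (by linarith) hkN' 2)
      (show (0 : ℝ) ≤ k by linarith)]
  calc endVariation N k g ≤ 2 * (1 / k) * cardEnergy N k δ g := by
        rw [mul_one_div, div_mul_eq_mul_div, le_div_iff₀ (by linarith)]
        linarith
    _ ≤ _ := by gcongr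

/-- The special boundary rates equal `(k² + 3j² - 1) / (4j² - 1)`, hence are at least one. -/
theorem one_le_specialRate {k j : ℕ} (hj : j ∈ Finset.Icc 2 (k - 1)) : 1 ≤ specialRate k j := by
  rw [Finset.mem_Icc] at hj
  have h1 : (2 : ℝ) ≤ j := by exact_mod_cast hj.1
  have h2 : (j : ℝ) ≤ k := by
    have : j ≤ k := by omega
    exact_mod_cast this
  have h3 : (0 : ℝ) < (2 * ((k : ℝ) - (k - j)) + 1) * (2 * ((k : ℝ) - (k - j)) - 1) := by
    have : (k : ℝ) - (k - j) = j := by ring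
    rw [this]
    nlinarith
  rw [specialRate, le_div_iff₀ h3]
  nlinarith

/-! ### From the spectral gap to the mixing of the deck -/

theorem abs_expect_cardGen_sub_le (hk : 2 ≤ k) (hkN : 2 * k ≤ N)
    (hδ : ∀ i ∈ Finset.Icc 2 (k - 1), 0 ≤ δ i)
    (hend : ∀ g : Fin N → ℝ,
      endVariation N k g ≤ 2 * ((N : ℝ) ^ 2 / (k : ℝ) ^ 3) * cardEnergy N k δ g)
    {t : ℝ} (ht : 165050 * (N : ℝ) ^ 2 / (k : ℝ) ^ 3 * Real.log N ≤ t) (m m' : Fin N) :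
    |expect (cardGen N k δ) t (fun m => ((m : ℕ) : ℝ)) m -
      expect (cardGen N k δ) t (fun m => ((m : ℕ) : ℝ)) m'| ≤ 2 / (N : ℝ) ^ 3 := by
  have hN : (2 : ℝ) ≤ N := by
    have : 2 ≤ N := by omega
    exact_mod_cast this
  have hkR : (2 : ℝ) ≤ k := by exact_mod_cast hk
  have hlog : 0 ≤ Real.log N := Real.log_nonneg (by linarith)
  have ht0 : 0 ≤ t := le_trans (by positivity) ht
  set c : ℝ := (k : ℝ) ^ 3 / (33010 * (N : ℝ) ^ 2) with hc
  have hgap : ∀ g : Fin N → ℝ, ∑ m, g m = 0 →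
      ∑ m, g m * cardGen N k δ g m ≤ -c * ∑ m, g m ^ 2 := by
    intro g hg
    have h := variation_univ_le_cardEnergy hk hkN hδ g (hend g)
    have h0 := sum_sq_sub_const Finset.univ g 0
    have ha : avg Finset.univ g = 0 := by simp [avg, hg]
    simp only [sub_zero, ha] at h0
    rw [sum_mul_cardGen_self, h0]
    have h1 : c * variation Finset.univ g ≤ cardEnergy N k δ g := by
      calc c * variation Finset.univ g
          ≤ c * (33010 * ((N : ℝ) ^ 2 / (k : ℝ) ^ 3) * cardEnergy N k δ g) := by gcongr
        _ = cardEnergy N k δ g := by rw [hc]; field_simp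
    linarith
  set p : Fin N → ℝ := fun m => ((m : ℕ) : ℝ) with hp
  set μ := avg Finset.univ p with hμ
  have hsum0 : ∑ m, (p m - μ) = 0 := by
    have := card_mul_avg Finset.univ p
    simp only [Finset.sum_sub_distrib, Finset.sum_const, nsmul_eq_mul, this, hμ, sub_self]
  have hsq : ∑ m, (p m - μ) ^ 2 ≤ (N : ℝ) ^ 4 := by
    calc ∑ m, (p m - μ) ^ 2 ≤ ∑ m, (p m - 0) ^ 2 := variation_le_sum_sq_sub _ _ _
      _ ≤ ∑ _m : Fin N, (N : ℝ) ^ 2 := by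
          refine Finset.sum_le_sum fun m _ => ?_
          have : p m ≤ N := by
            simp only [hp]
            exact_mod_cast m.2.le
          rw [sub_zero]
          gcongr
      _ = (N : ℝ) ^ 3 := by
          rw [Finset.sum_const, Finset.card_univ, Fintype.card_fin, nsmul_eq_mul]
          ring
      _ ≤ (N : ℝ) ^ 4 := pow_le_pow_right₀ (by linarith) (by norm_num)
  have hexp : Real.exp (-(c * t)) * (N : ℝ) ^ 2 ≤ 1 / (N : ℝ) ^ 3 := by
    have h1 : 5 * Real.log N ≤ c * t := by
      calc 5 * Real.log N = c * (165050 * (N : ℝ) ^ 2 / (k : ℝ) ^ 3 * Real.log N) := by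
            rw [hc]; field_simp; ring
        _ ≤ c * t := by gcongr
    have h2 : (N : ℝ) ^ 5 ≤ Real.exp (c * t) := by
      calc (N : ℝ) ^ 5 = Real.exp (5 * Real.log N) := by
            rw [show (5 : ℝ) * Real.log N = ((5 : ℕ) : ℝ) * Real.log N by norm_num,
              Real.exp_nat_mul, Real.exp_log (by linarith)]
        _ ≤ _ := Real.exp_le_exp.mpr h1
    rw [Real.exp_neg, inv_mul_eq_div, div_le_div_iff₀ (Real.exp_pos _) (by positivity)]
    calc (N : ℝ) ^ 2 * (N : ℝ) ^ 3 = (N : ℝ) ^ 5 := by ring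
      _ ≤ _ := by linarith
  have hdecay : ∀ m, |expect (cardGen N k δ) t p m - μ| ≤ 1 / (N : ℝ) ^ 3 := by
    intro m
    have h := sum_expect_sq_le (cardGen_isLinearMap N k δ) sum_cardGen hgap hsum0 ht0
    have e : expect (cardGen N k δ) t (fun m => p m - μ) m =
        expect (cardGen N k δ) t p m - μ := by
      have h1 := expect_const (cardGen_isLinearMap N k δ) cardGen_one t μ m
      simp only [expect] at h1 ⊢
      simp only [mul_sub, Finset.sum_sub_distrib, h1]
    have h1 : expect (cardGen N k δ) t (fun m => p m - μ) m ^ 2 ≤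
        (Real.exp (-(c * t)) * (N : ℝ) ^ 2) ^ 2 := by
      calc expect (cardGen N k δ) t (fun m => p m - μ) m ^ 2
          ≤ ∑ m, expect (cardGen N k δ) t (fun m => p m - μ) m ^ 2 :=
            Finset.single_le_sum
              (f := fun m => expect (cardGen N k δ) t (fun m => p m - μ) m ^ 2)
              (fun _ _ => sq_nonneg _) (Finset.mem_univ m)
        _ ≤ Real.exp (-(2 * c * t)) * ∑ m, (p m - μ) ^ 2 := h
        _ ≤ Real.exp (-(2 * c * t)) * (N : ℝ) ^ 4 := by gcongr
        _ = (Real.exp (-(c * t)) * (N : ℝ) ^ 2) ^ 2 := by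
            rw [mul_pow, ← Real.exp_nat_mul]
            push_cast
            ring_nf
    rw [← e]
    exact (abs_le_of_sq_le_sq h1 (by positivity)).trans hexp
  have h1 := hdecay m
  have h2 := hdecay m'
  rw [abs_le] at h1 h2 ⊢
  have e : 2 / (N : ℝ) ^ 3 = 1 / (N : ℝ) ^ 3 + 1 / (N : ℝ) ^ 3 := by ring
  rw [e]
  constructor <;> linarith

theorem closeAt_of_endVariation_le (hk : 2 ≤ k) (hkN : 2 * k ≤ N)
    (hδ : ∀ i ∈ Finset.Icc 2 (k - 1), 0 ≤ δ i)
    (hend : ∀ g : Fin N → ℝ,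
      endVariation N k g ≤ 2 * ((N : ℝ) ^ 2 / (k : ℝ) ^ 3) * cardEnergy N k δ g)
    (σ σ' : Equiv.Perm (Fin N)) {t : ℝ}
    (ht : 165050 * (N : ℝ) ^ 2 / (k : ℝ) ^ 3 * Real.log N ≤ t) : CloseAt N k δ t σ σ' := by
  refine ⟨fstMarginal_couplingLaw N k δ t σ σ', sndMarginal_couplingLaw N k δ t σ σ', ?_⟩
  have hN : (2 : ℝ) ≤ N := by
    have : 2 ≤ N := by omega
    exact_mod_cast this
  have ht0 : 0 ≤ t := le_trans (by
    have : 0 ≤ Real.log N := Real.log_nonneg (by linarith)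
    positivity) ht
  have hJ := couplingLaw_nonneg (N := N) hδ ht0 σ σ'
  -- Two different decks have a card at two different positions, hence at distance at least one.
  have hpt : ∀ y : Equiv.Perm (Fin N) × Equiv.Perm (Fin N),
      (if y.1 = y.2 then 0 else couplingLaw N k δ t σ σ' y) ≤
        ∑ ℓ, couplingLaw N k δ t σ σ' y * |((y.1.symm ℓ : ℕ) : ℝ) - ((y.2.symm ℓ : ℕ) : ℝ)| := by
    intro y
    split_ifs with h
    · exact Finset.sum_nonneg fun _ _ => mul_nonneg (hJ y) (abs_nonneg _)
    · obtain ⟨ℓ, hℓ⟩ : ∃ ℓ, y.1.symm ℓ ≠ y.2.symm ℓ := by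
        by_contra! h'
        exact h (Equiv.symm_bijective.injective (Equiv.ext h'))
      have h1 : (1 : ℝ) ≤ |((y.1.symm ℓ : ℕ) : ℝ) - ((y.2.symm ℓ : ℕ) : ℝ)| := by
        have h2 : ((y.1.symm ℓ : ℕ) : ℤ) - ((y.2.symm ℓ : ℕ) : ℤ) ≠ 0 := by
          intro h3
          exact hℓ (Fin.ext (by omega))
        exact_mod_cast Int.one_le_abs h2
      refine le_trans (le_mul_of_one_le_right (hJ y) h1) ?_
      exact Finset.single_le_sum (f := fun ℓ => couplingLaw N k δ t σ σ' y *
        |((y.1.symm ℓ : ℕ) : ℝ) - ((y.2.symm ℓ : ℕ) : ℝ)|)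
        (fun _ _ => mul_nonneg (hJ y) (abs_nonneg _)) (Finset.mem_univ ℓ)
  calc tvDist (sndMarginal (couplingLaw N k δ t σ σ')) (fstMarginal (couplingLaw N k δ t σ σ'))
      ≤ ∑ y, if y.1 = y.2 then 0 else couplingLaw N k δ t σ σ' y := tvDist_marginals_le hJ
    _ ≤ ∑ y, ∑ ℓ, couplingLaw N k δ t σ σ' y *
          |((y.1.symm ℓ : ℕ) : ℝ) - ((y.2.symm ℓ : ℕ) : ℝ)| := Finset.sum_le_sum fun y _ => hpt y
    _ = ∑ ℓ, ∑ y, couplingLaw N k δ t σ σ' y *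
          |((y.1.symm ℓ : ℕ) : ℝ) - ((y.2.symm ℓ : ℕ) : ℝ)| := Finset.sum_comm
    _ ≤ ∑ _ℓ : Fin N, 2 / (N : ℝ) ^ 3 := Finset.sum_le_sum fun ℓ _ =>
        (sum_couplingLaw_abs_sub_le k δ t σ σ' ℓ).trans
          (abs_expect_cardGen_sub_le hk hkN hδ hend ht _ _)
    _ = 2 / (N : ℝ) ^ 2 := by
        simp only [Finset.sum_const, Finset.card_univ, Fintype.card_fin, nsmul_eq_mul]
        field_simp
    _ ≤ 1 / N := by
        rw [div_le_div_iff₀ (by positivity) (by linarith)]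
        nlinarith

end CardChain

end SkShuffle

theorem mainTheorem4 :
    ∃ C : ℝ, 0 < C ∧
      (∀ k : ℕ → ℕ, (∀ᶠ N : ℕ in atTop, 2 ≤ k N) →
        (fun N : ℕ => (k N : ℝ)) =o[atTop] (fun N : ℕ => (N : ℝ) ^ (2 / 3 : ℝ)) →
        ∀ᶠ N : ℕ in atTop, ∀ δ : ℕ → ℝ,
          (∀ i ∈ Finset.Icc 2 (k N - 1), δ i ∈ Set.Icc (0 : ℝ) 1) →
          ∀ σ σ' : Equiv.Perm (Fin N), ∀ t : ℝ,
            C * (N : ℝ) ^ 2 / (k N : ℝ) ^ 3 * Real.log N ≤ t →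
            SkShuffle.CloseAt N (k N) δ t σ σ') ∧
      (∀ k : ℕ → ℕ, (∀ᶠ N : ℕ in atTop, 2 ≤ k N) →
        (fun N : ℕ => (k N : ℝ)) =o[atTop] (fun N : ℕ => (N : ℝ)) →
        ∀ᶠ N : ℕ in atTop,
          ∀ σ σ' : Equiv.Perm (Fin N), ∀ t : ℝ,
            C * (N : ℝ) ^ 2 / (k N : ℝ) ^ 3 * Real.log N ≤ t →
            SkShuffle.CloseAt N (k N) (SkShuffle.specialRate (k N)) t σ σ') := by
  refine ⟨165050, by norm_num, fun k hk ho => ?_, fun k hk ho => ?_⟩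
  · filter_upwards [hk, ho.bound (c := 1 / 2) (by norm_num), eventually_ge_atTop 1]
      with N hkN hoN hN δ hδ σ σ' t ht
    have hN1 : (1 : ℝ) ≤ N := by exact_mod_cast hN
    rw [Real.norm_of_nonneg (by positivity), Real.norm_of_nonneg (by positivity)] at hoN
    have hpow : ((N : ℝ) ^ (2 / 3 : ℝ)) ^ 3 = (N : ℝ) ^ 2 := by
      rw [← Real.rpow_natCast, ← Real.rpow_mul (by positivity)]
      norm_num
    have hle : (N : ℝ) ^ (2 / 3 : ℝ) ≤ N := by
      simpa using Real.rpow_le_rpow_of_exponent_le hN1 (show (2 / 3 : ℝ) ≤ 1 by norm_num)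
    have h0 : (0 : ℝ) ≤ (N : ℝ) ^ (2 / 3 : ℝ) := by positivity
    have h2k : 2 * k N ≤ N := by
      have : (2 : ℝ) * k N ≤ N := by linarith
      exact_mod_cast this
    have hcube : (k N : ℝ) ^ 3 ≤ (N : ℝ) ^ 2 := by
      rw [← hpow]
      gcongr
      linarith
    have hδ0 : ∀ i ∈ Finset.Icc 2 (k N - 1), 0 ≤ δ i := fun i hi => (hδ i hi).1
    exact SkShuffle.closeAt_of_endVariation_le hkN h2k hδ0
      (SkShuffle.endVariation_le_of_cube_le hkN h2k hcube hδ0) σ σ' ht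
  · filter_upwards [hk, ho.bound (c := 1 / 2) (by norm_num)] with N hkN hoN σ σ' t ht
    rw [Real.norm_of_nonneg (by positivity), Real.norm_of_nonneg (by positivity)] at hoN
    have h2k : 2 * k N ≤ N := by
      have : (2 : ℝ) * k N ≤ N := by linarith
      exact_mod_cast this
    have hδ1 : ∀ i ∈ Finset.Icc 2 (k N - 1), 1 ≤ SkShuffle.specialRate (k N) i :=
      fun i hi => SkShuffle.one_le_specialRate hi
    exact SkShuffle.closeAt_of_endVariation_le hkN h2k (fun i hi => zero_le_one.trans (hδ1 i hi))
      (SkShuffle.endVariation_le_of_one_le hkN h2k hδ1) σ σ' ht
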